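/- For positive integers $k_1,\dots,k_r$ put $\mathrm{Li}_k(z)=\sum_{m\ge1} z^m/m^k$ $(|z|<1)$ and let the Ito zeta function be \[\xi_{MT}(k_1,\dots,k_r;s)=\frac1{\Gamma(s)}\int_0^\infty t^{s-1}\,\frac{\prod_{i=1}^r \mathrm{Li}_{k_i}(1-e^{-t})}{e^t-1}\,dt\qquad(\Re s>1-r).\] For finite tuples $\mathbf s_i=(s_{i,1},\dots,s_{i,n_i})\in\mathbb C^{n_i}$ $(1\le i\le r)$ and $s\in\mathbb C$ let the generalized Mordell--Tornheim (GMT-type) multiple zeta function with one last argument be \[\zeta_{MT}(\mathbf s_1,\dots,\mathbf s_r;s)=\sum_{m_{i,j}\ge 1\ (1\le i\le r,\,1\le j\le n_i)}\ \frac{1}{\prod_{i=1}^r\prod_{q=1}^{n_i}(m_{i,1}+\dots+m_{i,q})^{s_{i,q}}\ \bigl(\sum_{i=1}^r\sum_{j=1}^{n_i}m_{i,j}\bigr)^{s}},\] where empty tuples ($n_i=0$) are simply omitted and a one-term tuple $(0)$ is written $0$. Both functions are extended in $s$ by meromorphic continuation. Let $l\ge0$ and $r\ge1$ be integers and let $k_1,\dots,k_r\ge2$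 be integers; $\{1\}^n$ denotes $n$ repetitions of $1$. For $\mathbf j=(j_1,\dots,j_r)$ with $0\le j_i\le 2k_i-2$ put \[a_r(\mathbf j,\mathbf k)=\prod_{i=1}^r a(j_i,k_i),\qquad a(j,k)=\begin{cases}(-1)^{j}\zeta(k-j)&(j<k-1),\\(-1)^{k-1}&(j\ge k-1),\end{cases}\] \[b_r(\mathbf j,\mathbf k)=\bigl|\{i\in\{1,\dots,r\}: j_i=k_i-1\}\bigr|,\qquad \mathbf k(j,k)=\begin{cases}(\{1\}^{j})&(j\le k-1),\\(\{1\}^{j-k},2,\{1\}^{2k-2-j})&(j>k-1).\end{cases}\] Then the integral defining $\xi_{MT}(\{1\}^l,k_1,\dots,k_r;s)$ converges absolutely for $\Re s>1-(l+r)$ and continues to an entire function of $s$; for every $\mathbf j$ as above the series $\zeta_{MT}(0,\mathbf k(j_1,k_1),\dots,\mathbf k(j_r,k_r);s)$ converges absolutely for $\Re s>1$ and continues to a meromorphic function of $s$ on $\mathbb C$; and for $s\in\mathbb C$ \[\xi_{MT}(\{1\}^l,k_1,\dots,k_r;s)=\sum_{\substack{0\le j_1\le 2k_1-2\\ \vdots\\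 0\le j_r\le 2k_r-2}} a_r(\mathbf j,\mathbf k)\,\frac{\Gamma(l+b_r(\mathbf j,\mathbf k)+s)}{\Gamma(s)}\,\zeta_{MT}\bigl(0,\mathbf k(j_1,k_1),\dots,\mathbf k(j_r,k_r);\,l+b_r(\mathbf j,\mathbf k)+s\bigr),\] as an identity of meromorphic functions: it holds at every $s\notin\{0,-1,-2,\dots\}$ at which all the terms on the right are regular, and at every $s\in\mathbb C$ the right-hand side has at most a removable singularity, its limit there being the left-hand side. -/

import Mathlib

open Complex Filter Topology MeasureTheory

noncomputable section

namespace ItoGMT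

/-- `F` is the meromorphic continuation to `ℂ` of a function `f` given by a formula that is
meaningful on some right half-plane: `F` is meromorphic on `ℂ`, normalised (continuous at every
removable singularity, with value `0` at the poles), and equal to `f` on a right half-plane. -/
def IsMeromorphicContinuation (f F : ℂ → ℂ) : Prop :=
  MeromorphicNFOn F Set.univ ∧ ∃ σ : ℝ, ∀ s : ℂ, σ < s.re → F s = f s

/-- A meromorphic continuation is unique. -/
theorem IsMeromorphicContinuation.unique {f F G : ℂ → ℂ}
    (hF : IsMeromorphicContinuation f F) (hG : IsMeromorphicContinuation f G) : F = G := by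
  obtain ⟨hF, σ, hσ⟩ := hF
  obtain ⟨hG, τ, hτ⟩ := hG
  have hcl : IsClopen {x : ℂ | F =ᶠ[𝓝 x] G} := by
    refine ⟨isClosed_iff_frequently.2 fun x hx => ?_, isOpen_setOfPred_eventually_nhds⟩
    refine ((hF (Set.mem_univ x)).eventuallyEq_nhdsNE_iff_eventuallyEq_nhds
      (hG (Set.mem_univ x))).1 ?_
    refine ((hF (Set.mem_univ x)).meromorphicAt.frequently_eq_iff_eventuallyEq
      (hG (Set.mem_univ x)).meromorphicAt).1 fun hn => ?_
    obtain ⟨y, hy, hyn⟩ := (hx.and_eventually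
      (eventually_eventually_nhds.2 (eventually_nhdsWithin_iff.1 hn))).exists
    have h1 : ∀ᶠ z in 𝓝 y, z = x := by
      filter_upwards [hy, hyn] with z h2 h3
      by_contra h
      exact h3 h h2
    have h2 : ∃ᶠ z in 𝓝[≠] y, z = x := (h1.filter_mono nhdsWithin_le_nhds).frequently
    have hyx : y = x := h1.self_of_nhds
    subst hyx
    exact h2 eventually_mem_nhdsWithin
  have hne : (((max σ τ + 1 : ℝ) : ℂ)) ∈ {x : ℂ | F =ᶠ[𝓝 x] G} := by
    have ho : IsOpen {z : ℂ | max σ τ < z.re} := isOpen_lt continuous_const continuous_re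
    filter_upwards [ho.mem_nhds (show max σ τ < ((max σ τ + 1 : ℝ) : ℂ).re by simp)] with z hz
    rw [hσ z (lt_of_le_of_lt (le_max_left _ _) hz), hτ z (lt_of_le_of_lt (le_max_right _ _) hz)]
  have huniv := hcl.eq_univ ⟨_, hne⟩
  funext x
  have hx : x ∈ {x : ℂ | F =ᶠ[𝓝 x] G} := huniv ▸ Set.mem_univ x
  exact hx.self_of_nhds

open Classical in
/-- The meromorphic continuation of `f` to `ℂ` (it is unique if it exists; `f` itself is the
default if there is none). -/
def meromorphicContinuation (f : ℂ → ℂ) : ℂ → ℂ :=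
  if h : ∃ F, IsMeromorphicContinuation f F then h.choose else f

/-- The polylogarithm `Li_k(z) = ∑_{m ≥ 1} z ^ m / m ^ k`, for `|z| < 1`. -/
def polylog (k : ℕ) (z : ℂ) : ℂ := ∑' m : ℕ+, z ^ (m : ℕ) / (m : ℂ) ^ k

/-- The integrand `t ^ (s - 1) * ∏ i, Li_{k_i}(1 - e ^ (-t)) / (e ^ t - 1)`, for `t > 0`. -/
def itoIntegrand (k : List ℕ) (s : ℂ) (t : ℝ) : ℂ :=
  (t : ℂ) ^ (s - 1) * ((k.map fun κ => polylog κ (1 - exp (-t))).prod / (exp t - 1))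

/-- The defining integral of the Ito zeta function; it converges for `1 - r < Re s`, where `r` is
the number of entries of `k`. -/
def itoIntegral (k : List ℕ) (s : ℂ) : ℂ :=
  1 / Gamma s * ∫ t in Set.Ioi (0 : ℝ), itoIntegrand k s t

/-- The Ito zeta function `ξ_MT(k_1, …, k_r; s)` on the whole of `ℂ`. -/
def xiMT (k : List ℕ) : ℂ → ℂ := meromorphicContinuation (itoIntegral k)

/-- The general term of the generalized Mordell-Tornheim series with blocks `S 0, …, S (r - 1)` and
a single last argument `s`, in the positive integers `m i p`:
`1 / (∏ i, ∏ q, (m i 1 + ⋯ + m i q) ^ (S i q) * (∑ i, ∑ q, m i q) ^ s)`.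
The partial sums `m i 1 + ⋯ + m i q` run through the strictly increasing tuples of positive
integers. An empty block contributes nothing. -/
def gmtTerm {r : ℕ} (S : Fin r → List ℂ) (s : ℂ)
    (m : (i : Fin r) → Fin (S i).length → ℕ+) : ℂ :=
  1 / ((∏ i, ∏ q, (∑ p ∈ Finset.Iic q, (m i p : ℂ)) ^ (S i).get q) *
    (∑ i, ∑ q, (m i q : ℂ)) ^ s)

/-- The generalized Mordell-Tornheim series `ζ_MT(S 0, …, S (r - 1); s)`. -/
def gmtSeries {r : ℕ} (S : Fin r → List ℂ) (s : ℂ) : ℂ :=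
  ∑' m : (i : Fin r) → Fin (S i).length → ℕ+, gmtTerm S s m

/-- The generalized Mordell-Tornheim multiple zeta function `ζ_MT(S 0, …, S (r - 1); s)`, as a
function of `s` on the whole of `ℂ`. -/
def gmtZeta {r : ℕ} (S : Fin r → List ℂ) : ℂ → ℂ := meromorphicContinuation (gmtSeries S)

/-- The coefficient `a(j, k)`. -/
def coeffA (j k : ℕ) : ℂ :=
  if j + 1 < k then (-1) ^ j * riemannZeta ((k : ℂ) - j) else (-1) ^ (k - 1)

/-- The coefficient `a_r(j, k) = ∏ i, a(j_i, k_i)`. -/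
def prodA {r : ℕ} (j k : Fin r → ℕ) : ℂ := ∏ i, coeffA (j i) (k i)

/-- `b_r(j, k)`, the number of `i` with `j_i = k_i - 1`. -/
def countB {r : ℕ} (j k : Fin r → ℕ) : ℕ :=
  (Finset.univ.filter fun i => j i + 1 = k i).card

/-- The block `k(j, k)`: `j` ones if `j ≤ k - 1`, and `({1}^{j-k}, 2, {1}^{2k-2-j})` if `k ≤ j`
(used for `j ≤ 2k - 2`). -/
def block (j k : ℕ) : List ℂ :=
  if j < k then List.replicate j 1
  else List.replicate (j - k) 1 ++ 2 :: List.replicate (2 * k - 2 - j) 1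

/-- The blocks `0, k(j_1, k_1), …, k(j_r, k_r)`. -/
def blocks {r : ℕ} (j k : Fin r → ℕ) : Fin (r + 1) → List ℂ :=
  Fin.cons [0] fun i => block (j i) (k i)

/-- The range `0 ≤ j_i ≤ 2 k_i - 2` of summation. -/
def indexRange {r : ℕ} (k : Fin r → ℕ) : Finset (Fin r → ℕ) :=
  Fintype.piFinset fun i => Finset.Icc 0 (2 * k i - 2)

/-- The finite sum
`∑ j, a_r(j, k) Γ(l + b_r + s) / Γ(s) * ζ_MT(0, k(j_1, k_1), …, k(j_r, k_r); l + b_r + s)`. -/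
def gmtSum (l : ℕ) {r : ℕ} (k : Fin r → ℕ) (s : ℂ) : ℂ :=
  ∑ j ∈ indexRange k, prodA j k * (Gamma (l + countB j k + s) / Gamma s) *
    gmtZeta (blocks j k) (l + countB j k + s)

end ItoGMT

end

namespace ItoGMT

open Asymptotics Set

/-! To a block of exponents attach the theta series `B(t) = ∑ exp(-(m_1 + ⋯ + m_n) t) / ∏ (m_1 + ⋯ +
m_q)^{e_q}` (`blockSeries`). Differentiation lowers its last exponent by one with a sign, and a last
exponent `0` sums out to the factor `1/(e^t - 1)`. So appending a `1` to a block inverts `f ↦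
-f/(e^t - 1)`, the same rule up to sign as `d/dt Li_{k+1}(1 - e^{-t}) = Li_k(1 - e^{-t})/(e^t - 1)`.
Starting from `Li_1(1 - e^{-t}) = t` and fixing each constant of integration by the limit `ζ(k)` at
infinity, induction on `k` writes `Li_k(1 - e^{-t})` as a finite combination of block series, with
one extra factor `t` at `j = k - 1` (`polylog_one_sub_exp_neg_eq_sum`). Multiplying out, the kernel
of `ξ_MT` becomes a finite sum of terms `t^{l+b}` times products of block series, the factor `1/(e^t
- 1)` being the block `(0)` (`itoKernel_eq_sum`). The Mellin transform of each product is `Γ · ζ_MT`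
and `t^{l+b}` shifts the variable, which gives the identity for `Re s > 1`
(`mellin_itoKernel_eq_sum`).

The continuations come from behaviour at `0+`. Block series have expansions in `t^a (log t)^b`, so
their Mellin transforms are meromorphic (`exists_meromorphicNFOn_mellin`). The Ito kernel is
`t^{l+r-1}` times a function analytic at `0`, so `1/Γ(s)` cancels all poles
(`exists_entire_inv_Gamma_mul_mellin`). Uniqueness of continuation carries the identity to `ℂ`. -/

/-! ### Identity theorem and gluing of continuations on half-planes. -/

theorem isConnected_halfPlane (σ : ℝ) : IsConnected {s : ℂ | σ < s.re} :=
  ⟨⟨((σ + 1 : ℝ) : ℂ), by simp⟩, (convex_halfSpace_re_gt σ).isPreconnected⟩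

theorem isOpen_halfPlane (σ : ℝ) : IsOpen {s : ℂ | σ < s.re} :=
  isOpen_lt continuous_const continuous_re

/-- Two meromorphic functions in normal form on a half-plane agree if they agree further right. -/
theorem meromorphicNFOn_eq_of_halfPlane {F G : ℂ → ℂ} {σ τ : ℝ}
    (hF : MeromorphicNFOn F {s | σ < s.re}) (hG : MeromorphicNFOn G {s | σ < s.re})
    (h : ∀ s : ℂ, τ < s.re → F s = G s) {s : ℂ} (hs : σ < s.re) : F s = G s := by
  have hm : MeromorphicOn (F - G) {s | σ < s.re} := hF.meromorphicOn.sub hG.meromorphicOn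
  have key : meromorphicOrderAt (F - G) s = ⊤ := by
    by_contra hne
    -- On a connected set a finite order at one point forces finite order everywhere, but `F - G`
    -- vanishes near `max σ τ + 1`.
    have hall := (hm.exists_meromorphicOrderAt_ne_top_iff_forall_mem
      (isConnected_halfPlane σ)).1 ⟨s, hs, hne⟩
    refine hall ((max σ τ + 1 : ℝ) : ℂ) (by simp [(le_max_left σ τ).trans_lt]) ?_
    refine meromorphicOrderAt_eq_top_iff.2 (Filter.Eventually.filter_mono nhdsWithin_le_nhds ?_)
    filter_upwards [(isOpen_halfPlane (max σ τ)).mem_nhds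
      (show max σ τ < ((max σ τ + 1 : ℝ) : ℂ).re by simp)] with z hz
    simp [h z ((le_max_right _ _).trans_lt hz)]
  have h1 : F =ᶠ[𝓝[≠] s] G := by
    filter_upwards [meromorphicOrderAt_eq_top_iff.1 key] with z hz
    exact sub_eq_zero.1 hz
  exact (((hF hs).eventuallyEq_nhdsNE_iff_eventuallyEq_nhds (hG hs)).1 h1).self_of_nhds

/-- Gluing of a family of continuations to larger and larger half-planes. -/
theorem exists_glued_continuation {f : ℂ → ℂ} {F : ℕ → ℂ → ℂ} {τ : ℕ → ℝ}
    (hF : ∀ N : ℕ, MeromorphicNFOn (F N) {s | -(N : ℝ) < s.re})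
    (h : ∀ N s, τ N < s.re → F N s = f s) :
    ∃ G : ℂ → ℂ, ∀ N : ℕ, ∀ s : ℂ, -(N : ℝ) < s.re → G s = F N s := by
  have hcomp : ∀ M N : ℕ, M ≤ N → ∀ s : ℂ, -(M : ℝ) < s.re → F M s = F N s := by
    intro M N hMN s hs
    refine meromorphicNFOn_eq_of_halfPlane (τ := max (τ M) (τ N)) (hF M) (fun z hz => hF N ?_)
      (fun z hz => ?_) hs
    · have : (M : ℝ) ≤ N := by exact_mod_cast hMN
      have hz' : -(M : ℝ) < z.re := hz
      change -(N : ℝ) < z.re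
      linarith
    · rw [h M z ((le_max_left _ _).trans_lt hz), h N z ((le_max_right _ _).trans_lt hz)]
  -- The `+ 1` puts `s` strictly inside the chosen half-plane.
  refine ⟨fun s => F (⌈-s.re⌉₊ + 1) s, fun N s hs => ?_⟩
  have h1 : -((⌈-s.re⌉₊ + 1 : ℕ) : ℝ) < s.re := by
    push_cast
    linarith [Nat.le_ceil (-s.re)]
  rcases le_total (⌈-s.re⌉₊ + 1) N with h2 | h2
  · exact hcomp _ _ h2 s h1
  · exact (hcomp _ _ h2 s hs).symm

theorem toMeromorphicNFOn_apply_of_analyticAt {F : ℂ → ℂ} {U : Set ℂ} (hF : MeromorphicOn F U)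
    {s : ℂ} (hs : s ∈ U) (h : AnalyticAt ℂ F s) : toMeromorphicNFOn F U s = F s := by
  rw [toMeromorphicNFOn_eq_toMeromorphicNFAt hF hs, toMeromorphicNFAt_eq_self.2 h.meromorphicNFAt]

/-- Each `F` need agree with `f` only far to the right, at an abscissa depending on `N`. Passing to
normal form makes the pieces agree on overlaps at every point, poles included. -/
theorem exists_meromorphicNFOn_univ_of_halfPlanes {f : ℂ → ℂ} {σ : ℝ}
    (hf : DifferentiableOn ℂ f {s | σ < s.re})
    (h : ∀ N : ℕ, ∃ F : ℂ → ℂ, MeromorphicOn F {s | -(N : ℝ) < s.re} ∧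
      ∃ τ : ℝ, ∀ s : ℂ, τ < s.re → F s = f s) :
    ∃ G : ℂ → ℂ, MeromorphicNFOn G Set.univ ∧ ∀ s : ℂ, σ < s.re → G s = f s := by
  choose F hF τ hτ using h
  have hlarge : ∀ N s, max (max σ (τ N)) (-(N : ℝ)) < s.re →
      toMeromorphicNFOn (F N) {s | -(N : ℝ) < s.re} s = f s := by
    intro N s hs
    obtain ⟨⟨h1, h2⟩, h3⟩ : (σ < s.re ∧ τ N < s.re) ∧ -(N : ℝ) < s.re := by
      simpa only [max_lt_iff] using hs
    rw [toMeromorphicNFOn_apply_of_analyticAt (hF N) h3, hτ N s h2]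
    have h4 : AnalyticAt ℂ f s := hf.analyticAt ((isOpen_halfPlane σ).mem_nhds h1)
    refine h4.congr ?_
    filter_upwards [(isOpen_halfPlane (τ N)).mem_nhds h2] with z hz using (hτ N z hz).symm
  obtain ⟨G, hG⟩ := exists_glued_continuation
    (fun N => meromorphicNFOn_toMeromorphicNFOn (F N) {s | -(N : ℝ) < s.re}) hlarge
  have hGnf : MeromorphicNFOn G Set.univ := by
    intro s _
    have h1 : -((⌈-s.re⌉₊ + 1 : ℕ) : ℝ) < s.re := by
      push_cast
      linarith [Nat.le_ceil (-s.re)]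
    refine (meromorphicNFAt_congr ?_).2
      (meromorphicNFOn_toMeromorphicNFOn (F (⌈-s.re⌉₊ + 1))
        {z | -((⌈-s.re⌉₊ + 1 : ℕ) : ℝ) < z.re} h1)
    filter_upwards [(isOpen_halfPlane _).mem_nhds h1] with z hz using hG _ z hz
  refine ⟨G, hGnf, fun s hs => ?_⟩
  refine meromorphicNFOn_eq_of_halfPlane (τ := max (max σ (τ 0)) (-((0 : ℕ) : ℝ)))
    (fun z _ => hGnf (Set.mem_univ z)) (fun z hz =>
    (hf.analyticAt ((isOpen_halfPlane σ).mem_nhds hz)).meromorphicNFAt) (fun z hz => ?_) hs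
  rw [hG 0 z ((le_max_right _ _).trans_lt hz), hlarge 0 z hz]

theorem exists_entire_of_halfPlanes {f : ℂ → ℂ} {σ : ℝ}
    (hf : DifferentiableOn ℂ f {s | σ < s.re})
    (h : ∀ N : ℕ, ∃ F : ℂ → ℂ, DifferentiableOn ℂ F {s | -(N : ℝ) < s.re} ∧
      ∃ τ : ℝ, ∀ s : ℂ, τ < s.re → F s = f s) :
    ∃ G : ℂ → ℂ, Differentiable ℂ G ∧ ∀ s : ℂ, σ < s.re → G s = f s := by
  choose F hF τ hτ using h
  have hnf : ∀ {g : ℂ → ℂ} {ρ : ℝ}, DifferentiableOn ℂ g {s | ρ < s.re} →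
      MeromorphicNFOn g {s | ρ < s.re} := fun hg z hz =>
    (hg.analyticAt ((isOpen_halfPlane _).mem_nhds hz)).meromorphicNFAt
  obtain ⟨G, hG⟩ := exists_glued_continuation (fun N => hnf (hF N)) hτ
  have hGd : Differentiable ℂ G := by
    intro s
    have h1 : -((⌈-s.re⌉₊ + 1 : ℕ) : ℝ) < s.re := by
      push_cast
      linarith [Nat.le_ceil (-s.re)]
    refine ((hF _).differentiableAt ((isOpen_halfPlane _).mem_nhds h1)).congr_of_eventuallyEq ?_
    filter_upwards [(isOpen_halfPlane _).mem_nhds h1] with z hz using hG _ z hz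
  refine ⟨G, hGd, fun s hs => ?_⟩
  refine meromorphicNFOn_eq_of_halfPlane (τ := max (τ 0) (-((0 : ℕ) : ℝ)))
    (hnf hGd.differentiableOn) (hnf hf) (fun z hz => ?_) hs
  rw [hG 0 z ((le_max_right _ _).trans_lt hz), hτ 0 z ((le_max_left _ _).trans_lt hz)]

/-! ### Asymptotic expansions at `0+` in powers of `t` and `log t`. -/

/-- The function `t ^ a * (log t) ^ b`. -/
noncomputable def logPower (a : ℤ) (b : ℕ) (t : ℝ) : ℂ := (t : ℂ) ^ a * (Real.log t : ℂ) ^ b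

/-- The span of the functions `t ^ a * (log t) ^ b`. -/
noncomputable def logPowers : Submodule ℂ (ℝ → ℂ) :=
  Submodule.span ℂ (range fun p : ℤ × ℕ => logPower p.1 p.2)

/-- `f` has, to every order, an asymptotic expansion at `0+` in the functions
`t ^ a * (log t) ^ b`. -/
def HasLogExpansion (f : ℝ → ℂ) : Prop :=
  ∀ N : ℕ, ∃ P ∈ logPowers, (f - P) =O[𝓝[>] 0] fun t : ℝ => t ^ N

theorem logPower_mem (a : ℤ) (b : ℕ) : logPower a b ∈ logPowers :=
  Submodule.subset_span ⟨(a, b), rfl⟩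

theorem logPowers_induction {p : (ℝ → ℂ) → Prop} (h : ∀ a b, p (logPower a b)) (h0 : p 0)
    (hadd : ∀ f g, p f → p g → p (f + g)) (hsmul : ∀ (c : ℂ) f, p f → p (c • f))
    {P : ℝ → ℂ} (hP : P ∈ logPowers) : p P := by
  refine Submodule.span_induction (p := fun f _ => p f) ?_ h0 (fun f g _ _ => hadd f g)
    (fun c f _ => hsmul c f) hP
  rintro _ ⟨⟨a, b⟩, rfl⟩
  exact h a b

theorem logPower_eqOn_mul (a b : ℤ) (m n : ℕ) :
    EqOn (logPower a m * logPower b n) (logPower (a + b) (m + n)) (Ioi 0) := by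
  intro t ht
  have : (t : ℂ) ≠ 0 := ofReal_ne_zero.2 (ne_of_gt ht)
  simp only [logPower, Pi.mul_apply, zpow_add₀ this, pow_add]
  ring

/-- Closure under products holds only on the positive axis: `t ^ (a + b) = t ^ a * t ^ b` can fail
at `t = 0`. -/
theorem exists_mul_mem_logPowers {P Q : ℝ → ℂ} (hP : P ∈ logPowers) (hQ : Q ∈ logPowers) :
    ∃ R ∈ logPowers, EqOn (P * Q) R (Ioi 0) := by
  revert hQ
  refine logPowers_induction (p := fun P => Q ∈ logPowers → ∃ R ∈ logPowers, EqOn (P * Q) R (Ioi 0))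
    (fun a m hQ => ?_) (fun _ => ⟨0, zero_mem _, fun t _ => by simp⟩) ?_ ?_ hP
  · refine logPowers_induction
      (p := fun Q => ∃ R ∈ logPowers, EqOn (logPower a m * Q) R (Ioi 0))
      (fun b n => ⟨_, logPower_mem _ _, logPower_eqOn_mul a b m n⟩)
      ⟨0, zero_mem _, fun t _ => by simp⟩ ?_ ?_ hQ
    · rintro f g ⟨R, hR, h⟩ ⟨S, hS, h'⟩
      exact ⟨R + S, add_mem hR hS, fun t ht => by
        simp only [Pi.mul_apply, Pi.add_apply, mul_add, ← h ht, ← h' ht]⟩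
    · rintro c f ⟨R, hR, h⟩
      exact ⟨c • R, Submodule.smul_mem _ _ hR, fun t ht => by
        simp only [Pi.mul_apply, Pi.smul_apply, smul_eq_mul, ← h ht]; ring⟩
  · rintro f g hf hg hQ
    obtain ⟨R, hR, h⟩ := hf hQ
    obtain ⟨S, hS, h'⟩ := hg hQ
    exact ⟨R + S, add_mem hR hS, fun t ht => by
      simp only [Pi.mul_apply, Pi.add_apply, add_mul, ← h ht, ← h' ht]⟩
  · rintro c f hf hQ
    obtain ⟨R, hR, h⟩ := hf hQ
    exact ⟨c • R, Submodule.smul_mem _ _ hR, fun t ht => by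
      simp only [Pi.mul_apply, Pi.smul_apply, smul_eq_mul, ← h ht]; ring⟩

theorem isBigO_zpow_zpow_nhdsGT_zero {a b : ℤ} (h : a ≤ b) :
    (fun t : ℝ => t ^ b) =O[𝓝[>] 0] fun t : ℝ => t ^ a := by
  refine IsBigO.of_bound 1 ?_
  filter_upwards [Ioo_mem_nhdsGT (zero_lt_one (α := ℝ))] with t ht
  rw [one_mul, Real.norm_of_nonneg (zpow_nonneg ht.1.le _),
    Real.norm_of_nonneg (zpow_nonneg ht.1.le _)]
  exact zpow_le_zpow_right_of_le_one₀ ht.1 ht.2.le h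

theorem isBigO_pow_zpow_nhdsGT_zero {a : ℤ} {N : ℕ} (h : a ≤ N) :
    (fun t : ℝ => t ^ N) =O[𝓝[>] 0] fun t : ℝ => t ^ a := by
  simpa only [zpow_natCast] using isBigO_zpow_zpow_nhdsGT_zero h

theorem isBigO_log_nhdsGT_zero :
    (fun t : ℝ => (Real.log t : ℂ)) =O[𝓝[>] 0] fun t : ℝ => t ^ (-1 : ℤ) := by
  have h := (isBigO_rpow_zero_log_smul (E := ℝ) (a := 0) (b := 1) (f := fun _ => 1) zero_lt_one
    (by simpa using isBigO_refl (fun _ : ℝ => (1 : ℝ)) _))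
  refine (IsBigO.of_bound 1 (Filter.Eventually.of_forall fun t => ?_)).trans (h.congr_right
    fun t => ?_)
  · simp
  · rw [← Real.rpow_intCast]
    norm_num

theorem logPowers_isBigO {P : ℝ → ℂ} (hP : P ∈ logPowers) :
    ∃ M : ℕ, P =O[𝓝[>] 0] fun t : ℝ => t ^ (-(M : ℤ)) := by
  refine logPowers_induction (p := fun P => ∃ M : ℕ, P =O[𝓝[>] 0] fun t : ℝ => t ^ (-(M : ℤ)))
    -- With the crude bound `log t = O(t⁻¹)`, `t ^ a (log t) ^ b` is `O(t ^ (a - b))`.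
    (fun a b => ⟨(b - a).toNat, ?_⟩) ⟨0, isBigO_zero _ _⟩ ?_ ?_ hP
  · have h1 : (fun t : ℝ => (t : ℂ) ^ a) =O[𝓝[>] 0] fun t : ℝ => t ^ a :=
      IsBigO.of_bound 1 (Filter.Eventually.of_forall fun t => by simp)
    refine ((h1.mul (isBigO_log_nhdsGT_zero.pow b)).trans_eventuallyEq ?_).trans
      (isBigO_zpow_zpow_nhdsGT_zero (b := a - b) (by omega))
    filter_upwards [self_mem_nhdsWithin] with t ht
    have : t ≠ 0 := ne_of_gt ht
    rw [← zpow_natCast, ← zpow_mul, ← zpow_add₀ this]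
    congr 1
    ring
  · rintro f g ⟨M, hM⟩ ⟨N, hN⟩
    exact ⟨max M N, (hM.trans (isBigO_zpow_zpow_nhdsGT_zero (by simp))).add
      (hN.trans (isBigO_zpow_zpow_nhdsGT_zero (by simp)))⟩
  · rintro c f ⟨M, hM⟩
    exact ⟨M, hM.const_smul_left c⟩

theorem HasLogExpansion.isBigO {f : ℝ → ℂ} (hf : HasLogExpansion f) :
    ∃ M : ℕ, f =O[𝓝[>] 0] fun t : ℝ => t ^ (-(M : ℤ)) := by
  obtain ⟨P, hP, h⟩ := hf 0
  obtain ⟨M, hM⟩ := logPowers_isBigO hP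
  refine ⟨M, ?_⟩
  have h' : (f - P) =O[𝓝[>] 0] fun t : ℝ => t ^ (-(M : ℤ)) :=
    h.trans (isBigO_pow_zpow_nhdsGT_zero (by simp))
  simpa using h'.add hM

theorem HasLogExpansion.congr {f g : ℝ → ℂ} (hf : HasLogExpansion f) (h : f =ᶠ[𝓝[>] 0] g) :
    HasLogExpansion g := fun N => by
  obtain ⟨P, hP, hO⟩ := hf N
  exact ⟨P, hP, hO.congr' (by filter_upwards [h] with t ht; simp [ht]) EventuallyEq.rfl⟩

theorem HasLogExpansion.of_mem {P : ℝ → ℂ} (hP : P ∈ logPowers) : HasLogExpansion P :=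
  fun _ => ⟨P, hP, by rw [sub_self]; exact isBigO_zero _ _⟩

theorem hasLogExpansion_one : HasLogExpansion 1 := by
  refine (HasLogExpansion.of_mem (logPower_mem 0 0)).congr (Filter.Eventually.of_forall fun t => ?_)
  simp [logPower]

theorem HasLogExpansion.neg {f : ℝ → ℂ} (hf : HasLogExpansion f) :
    HasLogExpansion (-f) := fun N => by
  obtain ⟨P, hP, hO⟩ := hf N
  exact ⟨-P, neg_mem hP, hO.neg_left.congr_left fun t => by
    simp only [Pi.sub_apply, Pi.neg_apply]; ring⟩

theorem HasLogExpansion.mul {f g : ℝ → ℂ} (hf : HasLogExpansion f) (hg : HasLogExpansion g) :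
    HasLogExpansion (f * g) := fun N => by
  obtain ⟨M, hM⟩ := hf.isBigO
  obtain ⟨M', hM'⟩ := hg.isBigO
  -- From `f g - P Q = (f - P) g + (g - Q) P`: the extra orders `M'` and `M` pay for the growth of
  -- `g` and of `P`.
  obtain ⟨P, hP, hfP⟩ := hf (N + M')
  obtain ⟨Q, hQ, hgQ⟩ := hg (N + M)
  obtain ⟨R, hR, hPQ⟩ := exists_mul_mem_logPowers hP hQ
  refine ⟨R, hR, ?_⟩
  have hPO : P =O[𝓝[>] 0] fun t : ℝ => t ^ (-(M : ℤ)) := by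
    have h' : (f - P) =O[𝓝[>] 0] fun t : ℝ => t ^ (-(M : ℤ)) := hfP.trans 
      (isBigO_pow_zpow_nhdsGT_zero (by omega))
    simpa using hM.sub h'
  have key : ∀ K : ℕ, (fun t : ℝ => t ^ (N + K) * t ^ (-(K : ℤ))) =ᶠ[𝓝[>] 0] fun t => t ^ N := by
    intro K
    filter_upwards [self_mem_nhdsWithin] with t ht
    have : t ≠ 0 := ne_of_gt ht
    rw [zpow_neg, zpow_natCast, pow_add]
    field_simp
  have h1 := (hfP.mul hM').trans_eventuallyEq (key M')
  have h2 := (hgQ.mul hPO).trans_eventuallyEq (key M)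
  refine (h1.add h2).congr' ?_ EventuallyEq.rfl
  filter_upwards [self_mem_nhdsWithin] with t ht
  simp only [Pi.sub_apply, Pi.mul_apply, ← hPQ ht]
  ring

/-- For `b = 0` the truncated exponent `b - 1` is harmless, since its coefficient vanishes. -/
theorem hasDerivAt_logPower (a : ℤ) (b : ℕ) {t : ℝ} (ht : 0 < t) :
    HasDerivAt (logPower a b) (a * logPower (a - 1) b t + b * logPower (a - 1) (b - 1) t) t := by
  have ht' : (t : ℂ) ≠ 0 := ofReal_ne_zero.2 ht.ne'
  have h1 : HasDerivAt (fun u : ℝ => (u : ℂ) ^ a) (a * (t : ℂ) ^ (a - 1)) t :=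
    (hasDerivAt_zpow a (t : ℂ) (Or.inl ht')).comp_ofReal
  have h2 : HasDerivAt (fun u : ℝ => (Real.log u : ℂ)) ((t⁻¹ : ℝ) : ℂ) t :=
    (Real.hasDerivAt_log ht.ne').ofReal_comp
  convert! h1.mul (h2.pow b) using 1
  simp only [logPower, zpow_sub_one₀ ht', ofReal_inv, Pi.pow_apply]
  ring

/-- For `a = -1` the primitive is a power of the logarithm; otherwise integration by parts lowers
`b`. -/
theorem exists_primitive_logPower (a : ℤ) (b : ℕ) :
    ∃ Q ∈ logPowers, ∀ t : ℝ, 0 < t → HasDerivAt Q (logPower a b t) t := by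
  by_cases ha : a = -1
  · subst ha
    refine ⟨((b + 1 : ℕ) : ℂ)⁻¹ • logPower 0 (b + 1), Submodule.smul_mem _ _ (logPower_mem _ _),
      fun t ht => ?_⟩
    convert! (hasDerivAt_logPower 0 (b + 1) ht).const_smul (((b + 1 : ℕ) : ℂ)⁻¹) using 1
    have : ((b + 1 : ℕ) : ℂ) ≠ 0 := Nat.cast_ne_zero.2 b.succ_ne_zero
    simp only [Int.cast_zero, zero_mul, zero_add, smul_eq_mul, zero_sub, Nat.add_sub_cancel]
    field_simp
  · have ha' : ((a + 1 : ℤ) : ℂ) ≠ 0 := by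
      rw [Int.cast_ne_zero]; omega
    induction b with
    | zero =>
      refine ⟨((a + 1 : ℤ) : ℂ)⁻¹ • logPower (a + 1) 0, Submodule.smul_mem _ _ (logPower_mem _ _),
        fun t ht => ?_⟩
      convert! (hasDerivAt_logPower (a + 1) 0 ht).const_smul (((a + 1 : ℤ) : ℂ)⁻¹) using 1
      simp only [Nat.cast_zero, zero_mul, add_zero, smul_eq_mul, add_sub_cancel_right]
      field_simp
    | succ b ih =>
      obtain ⟨Q, hQ, h⟩ := ih
      refine ⟨((a + 1 : ℤ) : ℂ)⁻¹ • (logPower (a + 1) (b + 1) - ((b + 1 : ℕ) : ℂ) • Q),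
        Submodule.smul_mem _ _ (sub_mem (logPower_mem _ _) (Submodule.smul_mem _ _ hQ)),
        fun t ht => ?_⟩
      convert! ((hasDerivAt_logPower (a + 1) (b + 1) ht).sub
        ((h t ht).const_smul ((b + 1 : ℕ) : ℂ))).const_smul (((a + 1 : ℤ) : ℂ)⁻¹) using 1
      simp only [smul_eq_mul, add_sub_cancel_right, Nat.add_sub_cancel]
      field_simp

theorem exists_primitive_of_mem_logPowers {P : ℝ → ℂ} (hP : P ∈ logPowers) :
    ∃ Q ∈ logPowers, ∀ t : ℝ, 0 < t → HasDerivAt Q (P t) t := by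
  refine logPowers_induction
    (p := fun P => ∃ Q ∈ logPowers, ∀ t : ℝ, 0 < t → HasDerivAt Q (P t) t)
    exists_primitive_logPower ⟨0, zero_mem _, fun t _ => hasDerivAt_const t (0 : ℂ)⟩ ?_ ?_ hP
  · rintro f g ⟨Q, hQ, h⟩ ⟨R, hR, h'⟩
    exact ⟨Q + R, add_mem hQ hR, fun t ht => (h t ht).add (h' t ht)⟩
  · rintro c f ⟨Q, hQ, h⟩
    exact ⟨c • Q, Submodule.smul_mem _ _ hQ, fun t ht => (h t ht).const_smul c⟩

/-- A function with derivative `O(t ^ N)` at `0+` has a limit there, up to `O(t ^ (N + 1))`. -/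
theorem exists_isBigO_sub_const_of_hasDerivAt {D D' : ℝ → ℂ} {N : ℕ}
    (hD : ∀ t : ℝ, 0 < t → HasDerivAt D (D' t) t) (hO : D' =O[𝓝[>] 0] fun t : ℝ => t ^ N) :
    ∃ c : ℂ, (fun t => D t - c) =O[𝓝[>] 0] fun t : ℝ => t ^ (N + 1) := by
  obtain ⟨C, hC0, hC⟩ := hO.exists_pos
  obtain ⟨δ, hδ, hb⟩ := mem_nhdsGT_iff_exists_Ioo_subset.1 hC.bound
  -- Staying below `1` gives `t ^ N ≤ 1`, so `D` is Lipschitz with the single constant `C` and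
  -- therefore has a limit at `0+`.
  have hδ0 : (0 : ℝ) < min δ 1 := lt_min hδ zero_lt_one
  have hbound : ∀ u t : ℝ, 0 < u → u ≤ t → t < min δ 1 → ‖D t - D u‖ ≤ C * t ^ N * (t - u) := by
    intro u t hu hut ht
    have := (convex_Icc u t).norm_image_sub_le_of_norm_hasDerivWithin_le (f := D) (f' := D')
      (C := C * t ^ N) (fun x hx => (hD x (hu.trans_le hx.1)).hasDerivWithinAt) (fun x hx => ?_)
      (left_mem_Icc.2 hut) (right_mem_Icc.2 hut)
    · rwa [Real.norm_of_nonneg (sub_nonneg.2 hut)] at this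
    · have hx0 : 0 < x := hu.trans_le hx.1
      have h1 : ‖D' x‖ ≤ C * ‖x ^ N‖ :=
        hb ⟨hx0, hx.2.trans_lt (ht.trans_le (min_le_left _ _))⟩
      rw [Real.norm_of_nonneg (by positivity)] at h1
      exact h1.trans (by gcongr; exact hx.2)
  have hlip : LipschitzOnWith C.toNNReal D (Ioo 0 (min δ 1)) := by
    refine LipschitzOnWith.of_dist_le_mul fun x hx y hy => ?_
    rw [Real.coe_toNNReal _ hC0.le]
    wlog hxy : y ≤ x generalizing x y
    · rw [dist_comm, dist_comm x y]
      exact this y hy x hx (le_of_not_ge hxy)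
    rw [dist_eq_norm, Real.dist_eq, abs_of_nonneg (sub_nonneg.2 hxy)]
    refine (hbound y x hy.1 hxy hx.2).trans ?_
    have : x ^ N ≤ 1 := pow_le_one₀ hx.1.le (hx.2.le.trans (min_le_right _ _))
    have h2 := sub_nonneg.2 hxy
    calc C * x ^ N * (x - y) ≤ C * 1 * (x - y) := by gcongr
      _ = _ := by ring
  have hmem : Ioo 0 (min δ 1) ∈ 𝓝[>] (0 : ℝ) := Ioo_mem_nhdsGT hδ0
  have hcau : Cauchy (map D (𝓝[>] 0)) :=
    Cauchy.map_of_le ((cauchy_nhds (a := (0 : ℝ))).mono nhdsWithin_le_nhds)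
      hlip.uniformContinuousOn (le_principal_iff.2 hmem)
  obtain ⟨c, hc⟩ := cauchy_map_iff_exists_tendsto.1 hcau
  refine ⟨c, IsBigO.of_bound C ?_⟩
  filter_upwards [hmem] with t ht
  -- Letting `u → 0+` in `hbound` gives `‖D t - c‖ ≤ C t ^ (N + 1)`.
  have hlim : Tendsto (fun u => ‖D t - D u‖) (𝓝[>] 0) (𝓝 ‖D t - c‖) :=
    (tendsto_const_nhds.sub hc).norm
  refine le_of_tendsto hlim ?_
  filter_upwards [Ioo_mem_nhdsGT ht.1] with u hu
  refine (hbound u t hu.1 hu.2.le ht.2).trans ?_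
  rw [Real.norm_of_nonneg (pow_nonneg ht.1.le _), pow_succ, ← mul_assoc]
  have := hu.1
  have := ht.1
  gcongr
  linarith

/-- An expansion may be integrated term by term; the constant of integration is absorbed by the term
`t ^ 0`. -/
theorem HasLogExpansion.of_hasDerivAt {F f : ℝ → ℂ} (hf : HasLogExpansion f)
    (hF : ∀ t : ℝ, 0 < t → HasDerivAt F (f t) t) : HasLogExpansion F := fun N => by
  obtain ⟨P, hP, hO⟩ := hf N
  obtain ⟨Q, hQ, hd⟩ := exists_primitive_of_mem_logPowers hP
  obtain ⟨c, hc⟩ := exists_isBigO_sub_const_of_hasDerivAt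
    (fun t ht => (hF t ht).sub (hd t ht)) hO
  refine ⟨Q + c • logPower 0 0, add_mem hQ (Submodule.smul_mem _ _ (logPower_mem _ _)), ?_⟩
  refine (hc.trans ?_).congr_left fun t => ?_
  · simpa only [zpow_natCast] using isBigO_pow_zpow_nhdsGT_zero (a := N) (N := N + 1) (by simp)
  · simp [logPower, sub_sub]

theorem exists_polynomial_isBigO_of_analyticAt {h : ℂ → ℂ} (hh : AnalyticAt ℂ h 0) (N : ℕ) :
    ∃ c : ℕ → ℂ, (fun t : ℝ => h t - ∑ n ∈ Finset.range N, c n * (t : ℂ) ^ n) =O[𝓝[>] 0]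
      fun t : ℝ => t ^ N := by
  obtain ⟨p, hp⟩ := hh
  refine ⟨p.coeff, ?_⟩
  have h1 := (hp.isBigO_sub_partialSum_pow N).comp_tendsto
    (show Tendsto (fun t : ℝ => (t : ℂ)) (𝓝[>] 0) (𝓝 0) from
      (continuous_ofReal.tendsto' 0 0 ofReal_zero).mono_left nhdsWithin_le_nhds)
  refine (h1.congr_left fun t => ?_).trans (IsBigO.of_bound 1
    (Filter.Eventually.of_forall fun t => by simp))
  simp only [Function.comp, zero_add, FormalMultilinearSeries.partialSum,
    FormalMultilinearSeries.apply_eq_pow_smul_coeff, smul_eq_mul, mul_comm]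

theorem hasLogExpansion_of_analyticAt {h : ℂ → ℂ} (hh : AnalyticAt ℂ h 0) :
    HasLogExpansion fun t : ℝ => h t := fun N => by
  obtain ⟨c, hc⟩ := exists_polynomial_isBigO_of_analyticAt hh N
  refine ⟨∑ n ∈ Finset.range N, c n • logPower n 0,
    sum_mem fun n _ => Submodule.smul_mem _ _ (logPower_mem _ _), hc.congr_left fun t => ?_⟩
  simp [logPower, Finset.sum_apply]

/-! ### Mellin transforms and their continuation. -/

theorem isBigO_rpow_of_zpow {f : ℝ → ℂ} {n : ℤ} (h : f =O[𝓝[>] 0] fun t : ℝ => t ^ n) :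
    f =O[𝓝[>] 0] fun t : ℝ => t ^ (-(-(n : ℝ))) :=
  h.congr_right fun t => by rw [neg_neg, Real.rpow_intCast]

theorem locallyIntegrableOn_indicator {f : ℝ → ℂ} {A B : Set ℝ} (hA : MeasurableSet A)
    (hf : LocallyIntegrableOn f B) : LocallyIntegrableOn (indicator A f) B := fun x hx => by
  obtain ⟨u, hu, h⟩ := hf x hx
  exact ⟨u, hu, h.indicator hA⟩

theorem locallyIntegrableOn_of_mem_logPowers {P : ℝ → ℂ} (hP : P ∈ logPowers) :
    LocallyIntegrableOn P (Ioi 0) := by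
  refine ContinuousOn.locallyIntegrableOn ?_ measurableSet_Ioi
  refine logPowers_induction (p := fun P => ContinuousOn P (Ioi 0))
    (fun a b t ht => (hasDerivAt_logPower a b ht).continuousAt.continuousWithinAt)
    continuousOn_const (fun f g hf hg => hf.add hg) (fun c f hf => hf.const_smul c) hP

theorem isBigO_atTop_indicator_Ioc (P : ℝ → ℂ) (g : ℝ → ℝ) :
    indicator (Ioc 0 1) P =O[atTop] g := by
  refine (isBigO_zero g atTop).congr' ?_ EventuallyEq.rfl
  filter_upwards [eventually_gt_atTop 1] with t ht
  rw [indicator_of_notMem fun h => (not_le.2 ht) h.2]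

theorem indicator_Ioc_eventuallyEq (P : ℝ → ℂ) : indicator (Ioc 0 1) P =ᶠ[𝓝[>] 0] P := by
  filter_upwards [Ioo_mem_nhdsGT (zero_lt_one (α := ℝ))] with t ht
  exact indicator_of_mem (show t ∈ Ioc (0 : ℝ) 1 from ⟨ht.1, ht.2.le⟩) P

/-- The transform of `t ^ a` on `(0, 1]` is `1 / (s + a)`, and each factor `log t` is a derivative
in `s`. -/
theorem exists_hasMellin_logPower (a : ℤ) (b : ℕ) :
    ∃ R : ℂ → ℂ, MeromorphicOn R univ ∧ ∃ σ : ℝ, ∀ s : ℂ, σ < s.re →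
      HasMellin (indicator (Ioc 0 1) (logPower a b)) s (R s) := by
  induction b with
  | zero =>
    refine ⟨fun s => 1 / (s + a), fun s _ => by fun_prop, -a, fun s hs => ?_⟩
    have h := hasMellin_cpow_Ioc (a : ℂ) (s := s) (by simpa using by linarith)
    have heq : logPower a 0 = fun t : ℝ => (t : ℂ) ^ (a : ℂ) := by
      funext t
      simp [logPower]
    rw [heq]
    exact h
  | succ b ih =>
    obtain ⟨R, hR, σ, h⟩ := ih
    obtain ⟨M, hM⟩ := logPowers_isBigO (logPower_mem a b)
    refine ⟨deriv R, fun s hs => (hR s hs).deriv, max σ (M : ℝ), fun s hs => ?_⟩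
    obtain ⟨hs1, hs2⟩ := max_lt_iff.1 hs
    have hO := isBigO_rpow_of_zpow (hM.congr' (indicator_Ioc_eventuallyEq _).symm EventuallyEq.rfl)
    -- The function vanishes beyond `1`, so any exponent above `Re s` serves as decay rate at
    -- infinity.
    obtain ⟨hconv, hder⟩ := mellin_hasDerivAt_of_isBigO_rpow (s := s) (a := s.re + 1)
      (locallyIntegrableOn_indicator measurableSet_Ioc
        (locallyIntegrableOn_of_mem_logPowers (logPower_mem a b)))
      (isBigO_atTop_indicator_Ioc _ _) (lt_add_one _) hO (by simpa using hs2)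
    have heq : (fun t : ℝ => Real.log t • indicator (Ioc 0 1) (logPower a b) t) =
        indicator (Ioc 0 1) (logPower a (b + 1)) := by
      funext t
      by_cases ht : t ∈ Ioc (0 : ℝ) 1
      · simp only [indicator_of_mem ht, logPower, pow_succ, real_smul]
        ring
      · simp only [indicator_of_notMem ht, smul_zero]
    rw [heq] at hconv hder
    refine ⟨hconv, ?_⟩
    have hev : mellin (indicator (Ioc 0 1) (logPower a b)) =ᶠ[𝓝 s] R := by
      filter_upwards [(isOpen_halfPlane σ).mem_nhds hs1] with z hz using (h z hz).2
    exact (hder.congr_of_eventuallyEq hev.symm).deriv.symm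

theorem exists_hasMellin_of_mem_logPowers {P : ℝ → ℂ} (hP : P ∈ logPowers) :
    ∃ R : ℂ → ℂ, MeromorphicOn R univ ∧ ∃ σ : ℝ, ∀ s : ℂ, σ < s.re →
      HasMellin (indicator (Ioc 0 1) P) s (R s) := by
  refine logPowers_induction (p := fun P => ∃ R : ℂ → ℂ, MeromorphicOn R univ ∧ ∃ σ : ℝ,
    ∀ s : ℂ, σ < s.re → HasMellin (indicator (Ioc 0 1) P) s (R s)) exists_hasMellin_logPower
    ⟨0, fun s _ => MeromorphicAt.const 0 s, 0, fun s _ => ?_⟩ ?_ ?_ hP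
  · simp [HasMellin, MellinConvergent, mellin, indicator_zero']
  · rintro f g ⟨R, hR, σ, h⟩ ⟨R', hR', σ', h'⟩
    refine ⟨R + R', hR.add hR', max σ σ', fun s hs => ?_⟩
    obtain ⟨hs1, hs2⟩ := max_lt_iff.1 hs
    have := hasMellin_add (h s hs1).1 (h' s hs2).1
    rw [(h s hs1).2, (h' s hs2).2] at this
    rwa [indicator_add']
  · rintro c f ⟨R, hR, σ, h⟩
    refine ⟨fun s => c • R s, fun s hs => (MeromorphicAt.const c s).smul (hR s hs), σ,
      fun s hs => ?_⟩
    have := hasMellin_const_smul (h s hs).1 c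
    rw [(h s hs).2] at this
    have heq : indicator (Ioc 0 1) (c • f) = fun t => c • indicator (Ioc 0 1) f t :=
      indicator_const_smul (Ioc (0 : ℝ) 1) c f
    rw [heq]
    exact this

/-- The Mellin transform of a function with exponential decay and an asymptotic expansion at `0+`
in powers of `t` and `log t` continues meromorphically to `ℂ`. -/
theorem exists_meromorphicNFOn_mellin {G : ℝ → ℂ} {a : ℝ} (ha : 0 < a)
    (hG : LocallyIntegrableOn G (Ioi 0)) (htop : G =O[atTop] fun t => Real.exp (-a * t))
    (hexp : HasLogExpansion G) {σ : ℝ} (hd : DifferentiableOn ℂ (mellin G) {s | σ < s.re}) :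
    ∃ F : ℂ → ℂ, MeromorphicNFOn F univ ∧ ∀ s : ℂ, σ < s.re → F s = mellin G s := by
  refine exists_meromorphicNFOn_univ_of_halfPlanes hd fun N => ?_
  obtain ⟨P, hP, hO⟩ := hexp N
  obtain ⟨R, hR, τ, hτ⟩ := exists_hasMellin_of_mem_logPowers hP
  obtain ⟨M, hM⟩ := hexp.isBigO
  have hint : LocallyIntegrableOn (fun t => G t - indicator (Ioc 0 1) P t) (Ioi 0) :=
    hG.sub (locallyIntegrableOn_indicator measurableSet_Ioc
      (locallyIntegrableOn_of_mem_logPowers hP))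
  have htop' : (fun t => G t - indicator (Ioc 0 1) P t) =O[atTop] fun t => Real.exp (-a * t) :=
    htop.sub (isBigO_atTop_indicator_Ioc _ _)
  have hbot : (fun t => G t - indicator (Ioc 0 1) P t) =O[𝓝[>] 0] fun t : ℝ => t ^ (N : ℤ) := by
    simp only [zpow_natCast]
    refine hO.congr' ?_ EventuallyEq.rfl
    filter_upwards [indicator_Ioc_eventuallyEq P] with t ht
    simp [ht]
  -- Removing the expansion on `(0, 1]` leaves a transform holomorphic on `Re s > -N`; `R` carries
  -- the poles.
  refine ⟨fun s => mellin (fun t => G t - indicator (Ioc 0 1) P t) s + R s, ?_, max τ (M : ℝ),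
    fun s hs => ?_⟩
  · intro s hs
    refine MeromorphicAt.add (AnalyticAt.meromorphicAt ?_) (hR s (mem_univ s))
    refine DifferentiableOn.analyticAt (s := {s : ℂ | -(N : ℝ) < s.re}) (fun z hz => ?_)
      ((isOpen_halfPlane _).mem_nhds hs)
    exact (mellin_differentiableAt_of_isBigO_rpow_exp ha hint htop' (isBigO_rpow_of_zpow hbot)
      (by simpa using hz)).differentiableWithinAt
  · obtain ⟨hs1, hs2⟩ := max_lt_iff.1 hs
    have hc : MellinConvergent G s := mellinConvergent_of_isBigO_rpow_exp ha hG htop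
      (isBigO_rpow_of_zpow hM) (by simpa using hs2)
    dsimp only
    rw [(hasMellin_sub hc (hτ s hs1).1).2, (hτ s hs1).2, sub_add_cancel]

/-- `1 / (Γ(s) (s + n))` continues to an entire function. -/
theorem exists_entire_inv_Gamma_div (n : ℕ) :
    ∃ E : ℂ → ℂ, Differentiable ℂ E ∧ ∀ s : ℂ, s + n ≠ 0 → E s = (Gamma s)⁻¹ * (1 / (s + n)) := by
  induction n with
  | zero =>
    refine ⟨fun s => (Gamma (s + 1))⁻¹, differentiable_one_div_Gamma.comp (by fun_prop),
      fun s hs => ?_⟩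
    have hs' : s ≠ 0 := by simpa using hs
    dsimp only
    rw [Gamma_add_one s hs']
    simp [mul_comm]
  | succ n ih =>
    obtain ⟨E, hE, h⟩ := ih
    -- The witness comes from `Γ(s + 1) = s Γ(s)`. At `s = 0` both sides vanish, by the convention
    -- `Γ(0) = 0`.
    refine ⟨fun s => s * E (s + 1), by fun_prop, fun s hs => ?_⟩
    have h1 : s + 1 + n ≠ 0 := by
      rwa [Nat.cast_add, Nat.cast_one, add_comm (n : ℂ) 1, ← add_assoc] at hs
    dsimp only
    rw [h _ h1]
    rcases eq_or_ne s 0 with rfl | hs0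
    · simp [Gamma_zero]
    rw [Gamma_add_one s hs0]
    push_cast
    rw [mul_inv, show s + ((n : ℂ) + 1) = s + 1 + n by ring]
    field_simp

/-- If `G` decays exponentially and is the restriction of a function analytic at `0`, then its
Mellin transform divided by `Γ` continues to an entire function. -/
theorem exists_entire_inv_Gamma_mul_mellin {G : ℝ → ℂ} {a : ℝ} (ha : 0 < a)
    (hG : LocallyIntegrableOn G (Ioi 0)) (htop : G =O[atTop] fun t => Real.exp (-a * t))
    {h : ℂ → ℂ} (hh : AnalyticAt ℂ h 0) (hGh : G =ᶠ[𝓝[>] 0] fun t => h t)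
    {σ : ℝ} (hd : DifferentiableOn ℂ (mellin G) {s | σ < s.re}) :
    ∃ F : ℂ → ℂ, Differentiable ℂ F ∧ ∀ s : ℂ, σ < s.re → F s = (Gamma s)⁻¹ * mellin G s := by
  have hΓ : Differentiable ℂ fun s : ℂ => (Gamma s)⁻¹ := differentiable_one_div_Gamma
  refine exists_entire_of_halfPlanes (hΓ.differentiableOn.mul hd) fun N => ?_
  obtain ⟨M, hM⟩ := ((hasLogExpansion_of_analyticAt hh).congr hGh.symm).isBigO
  obtain ⟨c, hc⟩ := exists_polynomial_isBigO_of_analyticAt hh N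
  choose E hE hE' using exists_entire_inv_Gamma_div
  set P : ℕ → ℝ → ℂ := fun n => indicator (Ioc 0 1) fun t : ℝ => (t : ℂ) ^ (n : ℂ) with hPdef
  have hPint : ∀ n, LocallyIntegrableOn (P n) (Ioi 0) := by
    intro n
    refine locallyIntegrableOn_indicator measurableSet_Ioc
      ((locallyIntegrableOn_of_mem_logPowers (logPower_mem n 0)).congr ?_)
    exact Filter.Eventually.of_forall fun t => by simp [logPower]
  set D : ℝ → ℂ := fun t => G t - ∑ n ∈ Finset.range N, c n • P n t with hD
  have hint : LocallyIntegrableOn D (Ioi 0) := by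
    refine hG.sub ?_
    have : ∀ A : Finset ℕ, LocallyIntegrableOn (fun t => ∑ n ∈ A, c n • P n t) (Ioi 0) := by
      intro A
      induction A using Finset.induction_on with
      | empty => simpa using (locallyIntegrable_const (0 : ℂ)).locallyIntegrableOn _
      | insert n A hn ih =>
        simp only [Finset.sum_insert hn]
        exact LocallyIntegrableOn.add (fun x hx => ((hPint n) x hx).smul (c n)) ih
    exact this _
  have htop' : D =O[atTop] fun t => Real.exp (-a * t) :=
    htop.sub (IsBigO.fun_sum fun n _ => (isBigO_atTop_indicator_Ioc _ _).const_smul_left (c n))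
  have hbot : D =O[𝓝[>] 0] fun t : ℝ => t ^ (N : ℤ) := by
    simp only [zpow_natCast]
    refine hc.congr' ?_ EventuallyEq.rfl
    filter_upwards [hGh, Ioo_mem_nhdsGT (zero_lt_one (α := ℝ))] with t ht ht'
    have : ∀ n, P n t = (t : ℂ) ^ n := fun n => by
      rw [hPdef]
      simp only [indicator_of_mem (show t ∈ Ioc (0 : ℝ) 1 from ⟨ht'.1, ht'.2.le⟩), cpow_natCast]
    simp [hD, ht, this]
  -- The Taylor term `t ^ n` contributes `1 / (s + n)`, whose pole is cancelled by the zero of `1 /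
  -- Γ` at `-n`.
  refine ⟨fun s => (Gamma s)⁻¹ * mellin D s + ∑ n ∈ Finset.range N, c n * E n s, ?_,
    max 0 (M : ℝ), fun s hs => ?_⟩
  · refine (hΓ.differentiableOn.mul fun z hz => ?_).add
      (Differentiable.fun_sum fun n _ => (hE n).const_mul (c n)).differentiableOn
    exact (mellin_differentiableAt_of_isBigO_rpow_exp ha hint htop' (isBigO_rpow_of_zpow hbot)
      (by simpa using hz)).differentiableWithinAt
  · obtain ⟨hs1, hs2⟩ := max_lt_iff.1 hs
    have hcv : MellinConvergent G s := mellinConvergent_of_isBigO_rpow_exp ha hG htop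
      (isBigO_rpow_of_zpow hM) (by simpa using hs2)
    have hPm : ∀ n, HasMellin (P n) s (1 / (s + n)) := fun n =>
      hasMellin_cpow_Ioc (n : ℂ) (by simpa using by positivity)
    have hsum : ∀ A : Finset ℕ, HasMellin (fun t => ∑ n ∈ A, c n • P n t) s
        (∑ n ∈ A, c n * (1 / (s + n))) := by
      intro A
      induction A using Finset.induction_on with
      | empty => simp [HasMellin, MellinConvergent, mellin]
      | insert n A hn ih =>
        have h1 := hasMellin_const_smul (hPm n).1 (c n)
        have := hasMellin_add h1.1 ih.1
        rw [h1.2, ih.2, (hPm n).2, smul_eq_mul] at this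
        simpa only [Finset.sum_insert hn] using this
    dsimp only
    rw [(hasMellin_sub hcv (hsum _).1).2, (hsum _).2, mul_sub, Finset.mul_sum, sub_add_eq_add_sub,
      sub_eq_iff_eq_add]
    congr 1
    refine Finset.sum_congr rfl fun n _ => ?_
    rw [hE' n s]
    · ring
    · intro h0
      have := congrArg re h0
      simp only [add_re, natCast_re, zero_re] at this
      linarith [(Nat.cast_nonneg n : (0 : ℝ) ≤ n)]

/-! ### Series of exponentials and the calculus of block series. -/

/-- The index types may vary with `i`, so this applies both to the entries of one block and to a
family of blocks. -/
theorem summable_norm_and_tsum_pi_prod {𝕜 : Type*} [NormedField 𝕜] [CompleteSpace 𝕜] {n : ℕ}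
    {α : Fin n → Type*} (f : ∀ i, α i → 𝕜) (hf : ∀ i, Summable fun x => ‖f i x‖) :
    (Summable fun m : ∀ i, α i => ‖∏ i, f i (m i)‖) ∧
      ∑' m : ∀ i, α i, ∏ i, f i (m i) = ∏ i, ∑' x, f i x := by
  induction n with
  | zero => exact ⟨Summable.of_finite, by simp [tsum_fintype]⟩
  | succ n ih =>
    obtain ⟨h1, h2⟩ := ih (fun i => f i.succ) fun i => hf i.succ
    have h3 : ∀ x : α 0 × (∀ i : Fin n, α i.succ),
        ∏ i, f i (Fin.consEquiv α x i) = f 0 x.1 * ∏ i : Fin n, f i.succ (x.2 i) := fun x => by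
      simp [Fin.prod_univ_succ, Fin.consEquiv]
    refine ⟨(Fin.consEquiv α).summable_iff.1 ?_, ?_⟩
    · simp only [Function.comp_def, h3]
      exact Summable.mul_norm (f := f 0)
        (g := fun m : ∀ i : Fin n, α i.succ => ∏ i : Fin n, f i.succ (m i)) (hf 0) h1
    · rw [← (Fin.consEquiv α).tsum_eq]
      simp only [h3]
      rw [Fin.prod_univ_succ, ← h2]
      exact (tsum_mul_tsum_of_summable_norm (f := f 0)
        (g := fun m : ∀ i : Fin n, α i.succ => ∏ i : Fin n, f i.succ (m i)) (hf 0) h1).symm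

section Dirichlet

variable {ι : Type*} {c : ι → ℂ} {p : ι → ℝ}

/-- With `t` made complex, the terms are holomorphic and dominated on `Re w > t / 2`, so termwise
differentiation follows from the theorem on series of holomorphic functions. -/
theorem hasDerivAt_dirichlet (hp : ∀ i, 0 ≤ p i)
    (hs : ∀ t : ℝ, 0 < t → Summable fun i => ‖c i‖ * Real.exp (-p i * t)) {t : ℝ} (ht : 0 < t) :
    HasDerivAt (fun t : ℝ => ∑' i, c i * (Real.exp (-p i * t) : ℂ))
      (-∑' i, (p i * c i) * (Real.exp (-p i * t) : ℂ)) t := by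
  have hd : ∀ (i : ι) (w : ℂ), HasDerivAt (fun w : ℂ => c i * exp (-p i * w))
      (-((p i * c i) * exp (-p i * w))) w := by
    intro i w
    convert! (((hasDerivAt_id w).const_mul (-(p i : ℂ))).cexp).const_mul (c i) using 1
    simp only [id, mul_one]
    ring
  have hle : ∀ (i : ι) (w : ℂ), w ∈ {s : ℂ | t / 2 < s.re} →
      ‖c i * exp (-p i * w)‖ ≤ ‖c i‖ * Real.exp (-p i * (t / 2)) := by
    intro i w hw
    have hw' : t / 2 < w.re := hw
    rw [norm_mul, norm_exp]
    gcongr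
    rw [← ofReal_neg, re_ofReal_mul]
    nlinarith [hp i]
  have hmem : (t : ℂ) ∈ {s : ℂ | t / 2 < s.re} := by
    change t / 2 < (t : ℂ).re
    simpa using half_lt_self ht
  have hdiff := differentiableOn_tsum_of_summable_norm (hs (t / 2) (half_pos ht))
    (fun i w _ => (hd i w).differentiableAt.differentiableWithinAt) (isOpen_halfPlane _) hle
  have hsum := hasSum_deriv_of_summable_norm (hs (t / 2) (half_pos ht))
    (fun i w _ => (hd i w).differentiableAt.differentiableWithinAt) (isOpen_halfPlane _) hle hmem
  have h := (hdiff.differentiableAt ((isOpen_halfPlane _).mem_nhds hmem)).hasDerivAt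
  rw [← hsum.tsum_eq] at h
  simp only [(hd _ _).deriv, tsum_neg] at h
  convert! h.comp_ofReal using 1
  · funext u
    simp
  · simp

theorem isBigO_atTop_dirichlet (hp : ∀ i, 1 ≤ p i)
    (hs : Summable fun i => ‖c i‖ * Real.exp (-p i * 1)) :
    (fun t : ℝ => ∑' i, c i * (Real.exp (-p i * t) : ℂ)) =O[atTop]
      fun t => Real.exp (-1 * t) := by
  -- For `p, t ≥ 1` one has `e^{-pt} ≤ e^{-p} e^{1-t}`.
  refine IsBigO.of_bound ((∑' i, ‖c i‖ * Real.exp (-p i * 1)) * Real.exp 1) ?_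
  filter_upwards [eventually_ge_atTop 1] with t ht
  rw [Real.norm_of_nonneg (Real.exp_pos _).le, mul_assoc, ← Real.exp_add]
  refine tsum_of_norm_bounded (hs.hasSum.mul_right _) fun i => ?_
  rw [norm_mul, norm_real, Real.norm_of_nonneg (Real.exp_pos _).le, mul_assoc, ← Real.exp_add]
  gcongr
  nlinarith [hp i]

end Dirichlet

/-- `1 / ∏ q, (m 1 + ⋯ + m q) ^ e q`. -/
noncomputable def tupleCoeff {n : ℕ} (e : Fin n → ℂ) (m : Fin n → ℕ+) : ℂ :=
  1 / ∏ q, (∑ p ∈ Finset.Iic q, (m p : ℂ)) ^ e q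

/-- `m 1 + ⋯ + m n`. -/
noncomputable def tupleSize {n : ℕ} (m : Fin n → ℕ+) : ℝ := ∑ q, (m q : ℝ)

/-- The series `∑ exp (-(m 1 + ⋯ + m n) t) / ∏ q, (m 1 + ⋯ + m q) ^ e q`. -/
noncomputable def tupleSeries {n : ℕ} (e : Fin n → ℂ) (t : ℝ) : ℂ :=
  ∑' m : Fin n → ℕ+, tupleCoeff e m * (Real.exp (-tupleSize m * t) : ℂ)

theorem one_le_cast_pnat (m : ℕ+) : (1 : ℝ) ≤ (m : ℝ) := 
  Nat.one_le_cast.2 m.pos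

theorem tupleSize_nonneg {n : ℕ} (m : Fin n → ℕ+) : 0 ≤ tupleSize m :=
  Finset.sum_nonneg fun _ _ => Nat.cast_nonneg _

theorem one_le_tupleSize {n : ℕ} (hn : 0 < n) (m : Fin n → ℕ+) : 1 ≤ tupleSize m :=
  (one_le_cast_pnat (m ⟨0, hn⟩)).trans
    (Finset.single_le_sum (f := fun q => (m q : ℝ)) (fun _ _ => Nat.cast_nonneg _)
      (Finset.mem_univ _))

theorem le_partialSum {n : ℕ} (m : Fin n → ℕ+) (q : Fin n) :
    (m q : ℝ) ≤ ∑ p ∈ Finset.Iic q, (m p : ℝ) :=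
  Finset.single_le_sum (f := fun q => (m q : ℝ)) (fun _ _ => Nat.cast_nonneg _)
    (Finset.mem_Iic.2 le_rfl)

theorem norm_partialSum_cpow {n : ℕ} (m : Fin n → ℕ+) (q : Fin n) (z : ℂ) :
    ‖(∑ p ∈ Finset.Iic q, (m p : ℂ)) ^ z‖ = (∑ p ∈ Finset.Iic q, (m p : ℝ)) ^ z.re := by
  have h : (∑ p ∈ Finset.Iic q, (m p : ℂ)) = ((∑ p ∈ Finset.Iic q, (m p : ℝ) : ℝ) : ℂ) := by
    push_cast; rfl
  rw [h, norm_cpow_eq_rpow_re_of_pos]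
  linarith [le_partialSum m q, one_le_cast_pnat (m q)]

theorem norm_tupleCoeff_le_one {n : ℕ} {e : Fin n → ℂ} (he : ∀ q, 0 ≤ (e q).re)
    (m : Fin n → ℕ+) : ‖tupleCoeff e m‖ ≤ 1 := by
  rw [tupleCoeff, norm_div, norm_one, norm_prod]
  refine div_le_one_of_le₀ ?_ (Finset.prod_nonneg fun _ _ => norm_nonneg _)
  refine Finset.prod_induction _ (fun x => 1 ≤ x) (fun a b => one_le_mul_of_one_le_of_one_le)
    le_rfl fun q _ => ?_
  rw [norm_partialSum_cpow]
  exact Real.one_le_rpow ((one_le_cast_pnat _).trans (le_partialSum m q)) (he q)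

theorem summable_exp_neg_pnat_mul {t : ℝ} (ht : 0 < t) :
    Summable fun m : ℕ+ => Real.exp (-(m : ℝ) * t) := by
  have h := Real.summable_exp_nat_mul_of_ge (c := -t) (by linarith) (f := fun n => (n : ℝ))
    (fun _ => le_rfl)
  refine (h.comp_injective PNat.coe_injective).congr fun m => ?_
  simp [mul_comm]

theorem summable_exp_neg_tupleSize {n : ℕ} {t : ℝ} (ht : 0 < t) :
    Summable fun m : Fin n → ℕ+ => Real.exp (-tupleSize m * t) := by
  refine (summable_norm_and_tsum_pi_prod (fun (_ : Fin n) (m : ℕ+) => Real.exp (-(m : ℝ) * t))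
    fun _ => (summable_exp_neg_pnat_mul ht).norm).1.congr fun m => ?_
  rw [← Real.exp_sum, Real.norm_of_nonneg (Real.exp_pos _).le, tupleSize, ← Finset.sum_mul,
    Finset.sum_neg_distrib]

theorem summable_norm_tupleSeries {n : ℕ} {e : Fin n → ℂ} (he : ∀ q, 0 ≤ (e q).re) {t : ℝ}
    (ht : 0 < t) : Summable fun m => ‖tupleCoeff e m‖ * Real.exp (-tupleSize m * t) :=
  (summable_exp_neg_tupleSize ht).of_nonneg_of_le (fun _ => by positivity) fun m =>
    mul_le_of_le_one_left (Real.exp_pos _).le (norm_tupleCoeff_le_one he m)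

/-- The last partial sum is the total size, which is also what multiplies `-t` in the exponential;
differentiation therefore acts on the last exponent alone. -/
theorem tupleCoeff_snoc {n : ℕ} (e : Fin n → ℂ) (a : ℂ) (m : Fin (n + 1) → ℕ+) :
    tupleCoeff (Fin.snoc (α := fun _ => ℂ) e a) m =
      tupleCoeff e (fun i => m i.castSucc) / (tupleSize m : ℂ) ^ a := by
  have h1 : Finset.Iic (Fin.last n) = Finset.univ := by
    ext i
    simp [Fin.le_last]
  have h2 : ∀ q : Fin n, ∑ p ∈ Finset.Iic q.castSucc, (m p : ℂ) =
      ∑ p ∈ Finset.Iic q, (m p.castSucc : ℂ) := fun q => by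
    rw [← Fin.map_castSuccEmb_Iic, Finset.sum_map]
    rfl
  have h3 : ((tupleSize m : ℝ) : ℂ) = ∑ q, (m q : ℂ) := by
    simp [tupleSize]
  rw [tupleCoeff, tupleCoeff, Fin.prod_univ_castSucc]
  simp only [Fin.snoc_castSucc, Fin.snoc_last, h1, h2, h3]
  rw [div_div]

theorem hasDerivAt_tupleSeries_snoc {n : ℕ} {e : Fin n → ℂ} (he : ∀ q, 0 ≤ (e q).re) {a : ℂ}
    (ha : 0 ≤ a.re) {t : ℝ} (ht : 0 < t) :
    HasDerivAt (tupleSeries (Fin.snoc (α := fun _ => ℂ) e (a + 1)))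
      (-tupleSeries (Fin.snoc (α := fun _ => ℂ) e a) t) t := by
  have he' : ∀ q, 0 ≤ (Fin.snoc (α := fun _ => ℂ) e (a + 1) q : ℂ).re := by
    intro q
    refine Fin.lastCases ?_ (fun i => ?_) q
    · simp only [Fin.snoc_last, add_re, one_re]
      linarith
    · simpa only [Fin.snoc_castSucc] using he i
  have h := hasDerivAt_dirichlet (fun m => tupleSize_nonneg m)
    (fun u hu => summable_norm_tupleSeries he' hu) ht
  convert! h using 2
  rw [tupleSeries]
  refine tsum_congr fun m => ?_
  have hm : (tupleSize m : ℂ) ≠ 0 :=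
    ofReal_ne_zero.2 (zero_lt_one.trans_le (one_le_tupleSize n.succ_pos m)).ne'
  rw [tupleCoeff_snoc, tupleCoeff_snoc, cpow_add _ _ hm, cpow_one]
  field_simp

theorem tsum_exp_neg_pnat_mul {t : ℝ} (ht : 0 < t) :
    ∑' m : ℕ+, ((Real.exp (-(m : ℝ) * t) : ℝ) : ℂ) = 1 / (exp t - 1) := by
  have h1 : ‖exp (-t : ℂ)‖ < 1 := by
    rw [norm_exp]
    simpa using ht
  have h2 : ∀ m : ℕ+, ((Real.exp (-(m : ℝ) * t) : ℝ) : ℂ) = exp (-t : ℂ) ^ (m : ℕ) := fun m => by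
    rw [← exp_nat_mul]
    push_cast
    congr 1
    ring
  simp only [h2]
  have h0 : exp (t : ℂ) ≠ 0 := exp_ne_zero _
  have h4 : (1 : ℂ) - exp (-t : ℂ) ≠ 0 := fun h => by
    rw [← sub_eq_zero.1 h] at h1
    simp at h1
  have h3 := tsum_pnat_eq_tsum_succ (f := fun n => exp (-t : ℂ) ^ n)
  rw [h3]
  simp only [pow_succ]
  rw [tsum_mul_right, tsum_geometric_of_norm_lt_one h1]
  rw [exp_neg] at h4 ⊢
  have h5 : exp (t : ℂ) - 1 ≠ 0 := fun h => h4 (by rw [sub_eq_zero.1 h]; simp)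
  field_simp

/-- With last exponent `0` the last variable occurs only in the exponential, and its geometric
series splits off. -/
theorem tupleSeries_snoc_zero {n : ℕ} {e : Fin n → ℂ} (he : ∀ q, 0 ≤ (e q).re) {t : ℝ}
    (ht : 0 < t) :
    tupleSeries (Fin.snoc (α := fun _ => ℂ) e 0) t = tupleSeries e t / (exp t - 1) := by
  rw [div_eq_mul_one_div, ← tsum_exp_neg_pnat_mul ht, mul_comm, tupleSeries, tupleSeries,
    ← (Fin.snocEquiv fun _ : Fin (n + 1) => ℕ+).tsum_eq, tsum_mul_tsum_of_summable_norm]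
  · refine tsum_congr fun x => ?_
    rw [tupleCoeff_snoc, cpow_zero, div_one]
    have h1 : (fun i : Fin n => Fin.snocEquiv (fun _ : Fin (n + 1) => ℕ+) x i.castSucc) = x.2 := by
      funext i
      simp [Fin.snocEquiv]
    have h2 : tupleSize (Fin.snocEquiv (fun _ : Fin (n + 1) => ℕ+) x) =
        tupleSize x.2 + (x.1 : ℝ) := by
      simp [tupleSize, Fin.sum_univ_castSucc, Fin.snocEquiv]
    rw [h1, h2, neg_add, add_mul, Real.exp_add, ofReal_mul]
    ring
  · simpa only [norm_real] using (summable_exp_neg_pnat_mul ht).norm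
  · simpa only [norm_mul, norm_real, Real.norm_of_nonneg (Real.exp_pos _).le] using
      summable_norm_tupleSeries he ht

theorem tupleSeries_congr {n n' : ℕ} (h : n = n') {e : Fin n → ℂ} {e' : Fin n' → ℂ}
    (he : ∀ i, e i = e' (Fin.cast h i)) : tupleSeries e = tupleSeries e' := by
  subst h
  have : e = e' := funext he
  rw [this]

/-- The series attached to a block of exponents. -/
noncomputable def blockSeries (S : List ℂ) (t : ℝ) : ℂ := tupleSeries S.get t

theorem blockSeries_append (S : List ℂ) (a : ℂ) :
    blockSeries (S ++ [a]) = tupleSeries (Fin.snoc (α := fun _ => ℂ) S.get a) := by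
  refine tupleSeries_congr (by simp) fun i => ?_
  obtain ⟨i, hi⟩ := i
  simp only [List.length_append, List.length_singleton] at hi
  rcases Nat.lt_succ_iff_lt_or_eq.1 hi with h | h
  · simp [Fin.snoc, h]
  · simp [Fin.snoc, h]

theorem blockSeries_nil (t : ℝ) : blockSeries [] t = 1 := by
  simp [blockSeries, tupleSeries, tupleCoeff, tupleSize, tsum_fintype]

theorem hasDerivAt_blockSeries_append {S : List ℂ} (hS : ∀ x ∈ S, 0 ≤ x.re) {a : ℂ}
    (ha : 0 ≤ a.re) {t : ℝ} (ht : 0 < t) :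
    HasDerivAt (blockSeries (S ++ [a + 1])) (-blockSeries (S ++ [a]) t) t := by
  rw [blockSeries_append, blockSeries_append]
  exact hasDerivAt_tupleSeries_snoc (fun q => hS _ (List.get_mem _ _)) ha ht

theorem blockSeries_append_zero {S : List ℂ} (hS : ∀ x ∈ S, 0 ≤ x.re) {t : ℝ} (ht : 0 < t) :
    blockSeries (S ++ [0]) t = blockSeries S t / (exp t - 1) := by
  rw [blockSeries_append]
  exact tupleSeries_snoc_zero (fun q => hS _ (List.get_mem _ _)) ht

/-- Lower the last exponent to `0`, then sum the last variable out. This mirrors the differential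
rule of `Li_k(1 - e^{-t})`. -/
theorem hasDerivAt_blockSeries_append_one {S : List ℂ} (hS : ∀ x ∈ S, 0 ≤ x.re) {t : ℝ}
    (ht : 0 < t) :
    HasDerivAt (blockSeries (S ++ [1])) (-(blockSeries S t / (exp t - 1))) t := by
  rw [← blockSeries_append_zero hS ht]
  simpa using hasDerivAt_blockSeries_append hS (a := 0) (by simp) ht

theorem hasDerivAt_blockSeries_append_two {S : List ℂ} (hS : ∀ x ∈ S, 0 ≤ x.re) {t : ℝ}
    (ht : 0 < t) : HasDerivAt (blockSeries (S ++ [2])) (-blockSeries (S ++ [1]) t) t := by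
  simpa [one_add_one_eq_two] using hasDerivAt_blockSeries_append hS (a := 1) (by simp) ht

theorem isBigO_atTop_blockSeries {S : List ℂ} (hS : ∀ x ∈ S, 0 ≤ x.re) (hne : S ≠ []) :
    blockSeries S =O[atTop] fun t => Real.exp (-1 * t) :=
  isBigO_atTop_dirichlet (fun m => one_le_tupleSize (List.length_pos_iff.2 hne) m)
    (summable_norm_tupleSeries (fun _ => hS _ (List.get_mem _ _)) zero_lt_one)

theorem exists_analyticAt_exp_sub_one :
    ∃ h : ℂ → ℂ, AnalyticAt ℂ h 0 ∧ ∀ z : ℂ, z ≠ 0 → 1 / (exp z - 1) = z⁻¹ * h z := by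
  obtain ⟨p, hp⟩ : AnalyticAt ℂ exp 0 := analyticAt_cexp
  have h1 : AnalyticAt ℂ (dslope exp 0) 0 := ⟨_, hp.has_fpower_series_dslope_fslope⟩
  refine ⟨fun z => (dslope exp 0 z)⁻¹, h1.inv (by simp [dslope_same]), fun z hz => ?_⟩
  dsimp only
  rw [dslope_of_ne _ hz, slope_def_field]
  simp only [sub_zero, exp_zero, inv_div, one_div]
  rw [div_eq_mul_inv, ← mul_assoc, inv_mul_cancel₀ hz, one_mul]

theorem hasLogExpansion_inv_exp_sub_one : HasLogExpansion fun t : ℝ => 1 / (exp t - 1) := by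
  obtain ⟨h, hh, heq⟩ := exists_analyticAt_exp_sub_one
  refine ((HasLogExpansion.of_mem (logPower_mem (-1) 0)).mul
    (hasLogExpansion_of_analyticAt hh)).congr ?_
  filter_upwards [self_mem_nhdsWithin] with t ht
  rw [heq _ (ofReal_ne_zero.2 (ne_of_gt ht))]
  simp [logPower]

/-- Built up from the right end: appending `1` is one integration against `1 / (e^t - 1)`, whose
pole at `0` can create logarithms; appending `2` is a further plain integration. -/
theorem hasLogExpansion_blockSeries {S : List ℂ} (hS : ∀ x ∈ S, x = 1 ∨ x = 2) :
    HasLogExpansion (blockSeries S) := by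
  have hre : ∀ {T : List ℂ}, (∀ x ∈ T, x = 1 ∨ x = 2) → ∀ x ∈ T, 0 ≤ x.re := by
    intro T hT x hx
    rcases hT x hx with rfl | rfl <;> simp
  induction S using List.reverseRecOn with
  | nil =>
    exact hasLogExpansion_one.congr (Filter.Eventually.of_forall fun t => by simp [blockSeries_nil])
  | append_singleton S a ih =>
    have hS' : ∀ x ∈ S, x = 1 ∨ x = 2 := fun x hx => hS x (by simp [hx])
    have h1 : HasLogExpansion (blockSeries (S ++ [1])) := by
      refine ((ih hS').mul hasLogExpansion_inv_exp_sub_one).neg.of_hasDerivAt fun t ht => ?_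
      simpa [div_eq_mul_inv] using hasDerivAt_blockSeries_append_one (hre hS') ht
    rcases hS a (by simp) with rfl | rfl
    · exact h1
    · exact h1.neg.of_hasDerivAt fun t ht => hasDerivAt_blockSeries_append_two (hre hS') ht

/-! ### The polylogarithm and its composition with `1 - e^{-t}`. -/

theorem norm_polylog_term_le (k : ℕ) {z : ℂ} {ρ : ℝ} (hz : ‖z‖ ≤ ρ) (m : ℕ+) :
    ‖z ^ (m : ℕ) / (m : ℂ) ^ k‖ ≤ ρ ^ (m : ℕ) := by
  rw [norm_div, norm_pow, norm_pow, norm_natCast]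
  refine (div_le_self (by positivity) (one_le_pow₀ (one_le_cast_pnat m))).trans ?_
  gcongr

theorem summable_pow_pnat {ρ : ℝ} (h0 : 0 ≤ ρ) (h1 : ρ < 1) :
    Summable fun m : ℕ+ => ρ ^ (m : ℕ) :=
  (summable_geometric_of_lt_one h0 h1).comp_injective PNat.coe_injective

theorem hasDerivAt_polylog (k : ℕ) {z : ℂ} (hz : ‖z‖ < 1) :
    HasDerivAt (polylog k) (∑' m : ℕ+, (m : ℂ) * z ^ ((m : ℕ) - 1) / (m : ℂ) ^ k) z := by
  obtain ⟨ρ, hρ, hρ1⟩ := exists_between hz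
  have hρ0 : 0 ≤ ρ := (norm_nonneg z).trans hρ.le
  have hd : ∀ (m : ℕ+) (w : ℂ), HasDerivAt (fun w : ℂ => w ^ (m : ℕ) / (m : ℂ) ^ k)
      ((m : ℂ) * w ^ ((m : ℕ) - 1) / (m : ℂ) ^ k) w := fun m w =>
    (hasDerivAt_pow (m : ℕ) w).div_const _
  have hle : ∀ (m : ℕ+) (w : ℂ), w ∈ Metric.ball (0 : ℂ) ρ →
      ‖w ^ (m : ℕ) / (m : ℂ) ^ k‖ ≤ ρ ^ (m : ℕ) := fun m w hw =>
    norm_polylog_term_le k (mem_ball_zero_iff.1 hw).le m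
  have hmem : z ∈ Metric.ball (0 : ℂ) ρ := mem_ball_zero_iff.2 hρ
  have hdiff := differentiableOn_tsum_of_summable_norm (summable_pow_pnat hρ0 hρ1)
    (fun m w _ => (hd m w).differentiableAt.differentiableWithinAt) Metric.isOpen_ball hle
  have hsum := hasSum_deriv_of_summable_norm (summable_pow_pnat hρ0 hρ1)
    (fun m w _ => (hd m w).differentiableAt.differentiableWithinAt) Metric.isOpen_ball hle hmem
  have h := (hdiff.differentiableAt (Metric.isOpen_ball.mem_nhds hmem)).hasDerivAt
  rw [← hsum.tsum_eq] at h
  simp only [(hd _ _).deriv] at h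
  exact h

theorem hasDerivAt_polylog_succ (k : ℕ) {z : ℂ} (hz : ‖z‖ < 1) (hz0 : z ≠ 0) :
    HasDerivAt (polylog (k + 1)) (polylog k z / z) z := by
  convert! hasDerivAt_polylog (k + 1) hz using 1
  rw [polylog, ← tsum_div_const]
  refine tsum_congr fun m => ?_
  have hm : (m : ℂ) ≠ 0 := Nat.cast_ne_zero.2 m.ne_zero
  rw [pow_succ, ← Nat.sub_add_cancel m.pos, pow_succ, Nat.add_sub_cancel]
  field_simp

theorem analyticAt_polylog (k : ℕ) : AnalyticAt ℂ (polylog k) 0 := by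
  refine DifferentiableOn.analyticAt (s := Metric.ball 0 1) (fun z hz => ?_)
    (Metric.ball_mem_nhds 0 one_pos)
  exact (hasDerivAt_polylog k (mem_ball_zero_iff.1 hz)).differentiableAt.differentiableWithinAt

theorem polylog_zero_right (k : ℕ) : polylog k 0 = 0 := by
  simp [polylog]

theorem polylog_one {z : ℂ} (hz : ‖z‖ < 1) : polylog 1 z = -log (1 - z) := by
  rw [← (hasSum_taylorSeries_neg_log hz).tsum_eq, polylog]
  rw [(hasSum_taylorSeries_neg_log hz).summable.tsum_eq_zero_add,
    tsum_pnat_eq_tsum_succ (f := fun n : ℕ => z ^ n / (n : ℂ) ^ 1)]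
  simp

theorem one_sub_exp_neg_eq (t : ℝ) : (1 : ℂ) - exp (-t) = ((1 - Real.exp (-t) : ℝ) : ℂ) := by
  push_cast
  rfl

theorem norm_one_sub_exp_neg_lt_one {t : ℝ} (ht : 0 < t) : ‖(1 : ℂ) - exp (-t)‖ < 1 := by
  have h1 : Real.exp (-t) < 1 := by simpa using ht
  rw [one_sub_exp_neg_eq, norm_real, Real.norm_of_nonneg (by linarith)]
  linarith [Real.exp_pos (-t)]

theorem exp_sub_one_ne_zero {t : ℝ} (ht : 0 < t) : exp (t : ℂ) - 1 ≠ 0 := by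
  rw [← ofReal_exp, ← ofReal_one, ← ofReal_sub]
  exact ofReal_ne_zero.2 (sub_pos.2 (Real.one_lt_exp_iff.2 ht)).ne'

theorem one_sub_exp_neg_ne_zero {t : ℝ} (ht : 0 < t) : (1 : ℂ) - exp (-t) ≠ 0 := by
  rw [one_sub_exp_neg_eq]
  exact ofReal_ne_zero.2 (sub_pos.2 (by simpa using ht)).ne'

theorem polylog_one_one_sub_exp_neg {t : ℝ} (ht : 0 < t) :
    polylog 1 (1 - exp (-t)) = t := by
  rw [polylog_one (norm_one_sub_exp_neg_lt_one ht), sub_sub_cancel, ← ofReal_neg, ← ofReal_exp,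
    ← ofReal_log (Real.exp_pos _).le, Real.log_exp]
  simp

/-- The chain rule, with `e^{-t} / (1 - e^{-t}) = 1 / (e^t - 1)`. -/
theorem hasDerivAt_polylog_one_sub_exp_neg (k : ℕ) {t : ℝ} (ht : 0 < t) :
    HasDerivAt (fun t : ℝ => polylog (k + 1) (1 - exp (-t)))
      (polylog k (1 - exp (-t)) / (exp t - 1)) t := by
  have h1 : HasDerivAt (fun z : ℂ => 1 - exp (-z)) (exp (-t)) (t : ℂ) := by
    simpa using ((hasDerivAt_id (t : ℂ)).neg.cexp).const_sub 1
  have h2 := ((hasDerivAt_polylog_succ k (norm_one_sub_exp_neg_lt_one ht)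
    (one_sub_exp_neg_ne_zero ht)).comp (t : ℂ) h1).comp_ofReal
  convert! h2 using 1
  have h3 := one_sub_exp_neg_ne_zero ht
  have h4 := exp_sub_one_ne_zero ht
  have h5 : exp (t : ℂ) * exp (-t) = 1 := by rw [← exp_add]; simp
  field_simp
  linear_combination (-polylog k (1 - exp (-t))) * h5

/-- Dominated convergence with majorant `1 / m ^ k`. This limit fixes the constants of integration
below. -/
theorem tendsto_polylog_one_sub_exp_neg {k : ℕ} (hk : 2 ≤ k) :
    Tendsto (fun t : ℝ => polylog k (1 - exp (-t))) atTop (𝓝 (riemannZeta k)) := by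
  have hsum : Summable fun m : ℕ => 1 / (m : ℝ) ^ k := Real.summable_one_div_nat_pow.2 (by omega)
  have hz : riemannZeta k = ∑' m : ℕ+, (1 : ℂ) ^ (m : ℕ) / (m : ℂ) ^ k := by
    have hs : Summable fun m : ℕ => 1 / (m : ℂ) ^ k := by
      rw [← summable_norm_iff]
      simpa using hsum
    rw [zeta_nat_eq_tsum_of_gt_one (by omega), hs.tsum_eq_zero_add,
      tsum_pnat_eq_tsum_succ (f := fun n : ℕ => (1 : ℂ) ^ n / (n : ℂ) ^ k)]
    simp [show k ≠ 0 by omega]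
  rw [hz]
  refine tendsto_tsum_of_dominated_convergence (hsum.comp_injective PNat.coe_injective)
    (fun m => ?_) ?_
  · refine Tendsto.div_const (Tendsto.pow ?_ _) _
    have : Tendsto (fun t : ℝ => ((1 - Real.exp (-t) : ℝ) : ℂ)) atTop (𝓝 ((1 - 0 : ℝ) : ℂ)) :=
      (continuous_ofReal.tendsto _).comp
        (tendsto_const_nhds.sub (Real.tendsto_exp_neg_atTop_nhds_zero))
    simpa using this
  · filter_upwards [eventually_gt_atTop 0] with t ht m
    rw [norm_div, norm_pow, norm_pow, norm_natCast]
    simp only [Function.comp]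
    gcongr
    exact pow_le_one₀ (norm_nonneg _) (norm_one_sub_exp_neg_lt_one ht).le

/-! ### Expansion of `Li_k(1 - e^{-t})` in block series. -/

/-- The non-zeta part of the expansion of `Li_{n+1}(1 - e ^ (-t))`, up to sign. -/
noncomputable def iteratedLogTerm (n : ℕ) (t : ℝ) : ℂ :=
  t * blockSeries (List.replicate n 1) t +
    ∑ a ∈ Finset.range n,
      blockSeries (List.replicate a 1 ++ 2 :: List.replicate (n - 1 - a) 1) t

theorem re_nonneg_of_mem_replicate {n : ℕ} : ∀ x ∈ List.replicate n (1 : ℂ), 0 ≤ x.re := by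
  intro x hx
  simp [List.eq_of_mem_replicate hx]

theorem re_nonneg_of_mem_replicate_two {a b : ℕ} :
    ∀ x ∈ List.replicate a (1 : ℂ) ++ 2 :: List.replicate b 1, 0 ≤ x.re := by
  intro x hx
  simp only [List.mem_append, List.mem_cons, List.mem_replicate] at hx
  rcases hx with ⟨_, rfl⟩ | rfl | ⟨_, rfl⟩ <;> simp

theorem hasDerivAt_blockSeries_replicate (n : ℕ) {t : ℝ} (ht : 0 < t) :
    HasDerivAt (blockSeries (List.replicate (n + 1) 1))
      (-(blockSeries (List.replicate n 1) t / (exp t - 1))) t := by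
  rw [List.replicate_succ']
  exact hasDerivAt_blockSeries_append_one re_nonneg_of_mem_replicate ht

/-- The product rule on `t · B({1}^{n+1})` leaves a stray `B({1}^{n+1})`, which the derivative of
the new summand `B({1}^n, 2)` cancels. This is why blocks containing a `2` occur. -/
theorem hasDerivAt_iteratedLogTerm (n : ℕ) {t : ℝ} (ht : 0 < t) :
    HasDerivAt (iteratedLogTerm (n + 1)) (-(iteratedLogTerm n t / (exp t - 1))) t := by
  have h1 : HasDerivAt (fun u : ℝ => (u : ℂ) * blockSeries (List.replicate (n + 1) 1) u)
      (1 * blockSeries (List.replicate (n + 1) 1) t +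
        t * -(blockSeries (List.replicate n 1) t / (exp t - 1))) t :=
    ((hasDerivAt_id t).ofReal_comp).mul (hasDerivAt_blockSeries_replicate n ht)
  have h2 : HasDerivAt (blockSeries (List.replicate n 1 ++ [2]))
      (-blockSeries (List.replicate (n + 1) 1) t) t := by
    rw [List.replicate_succ']
    exact hasDerivAt_blockSeries_append_two re_nonneg_of_mem_replicate ht
  have h3 : HasDerivAt (fun u : ℝ => ∑ a ∈ Finset.range n,
      blockSeries (List.replicate a 1 ++ 2 :: List.replicate (n - a) 1) u)
      (∑ a ∈ Finset.range n, -(blockSeries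
        (List.replicate a 1 ++ 2 :: List.replicate (n - 1 - a) 1) t / (exp t - 1))) t := by
    refine HasDerivAt.fun_sum fun a ha => ?_
    have ha' := Finset.mem_range.1 ha
    have h4 : List.replicate a (1 : ℂ) ++ 2 :: List.replicate (n - a) 1 =
        (List.replicate a (1 : ℂ) ++ 2 :: List.replicate (n - 1 - a) 1) ++ [1] := by
      rw [show n - a = n - 1 - a + 1 by omega, List.replicate_succ']
      simp
    rw [h4]
    exact hasDerivAt_blockSeries_append_one re_nonneg_of_mem_replicate_two ht
  convert! h1.add (h3.add h2) using 1
  · funext u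
    simp [iteratedLogTerm, Finset.sum_range_succ]
  · simp only [iteratedLogTerm, add_div, Finset.sum_div, Finset.sum_neg_distrib]
    ring

theorem tendsto_zero_of_isBigO_exp {f : ℝ → ℂ} (hf : f =O[atTop] fun t => Real.exp (-1 * t)) :
    Tendsto (fun t : ℝ => (t : ℂ) * f t) atTop (𝓝 0) ∧ Tendsto f atTop (𝓝 0) := by
  have h1 := isLittleO_exp_neg_mul_rpow_atTop zero_lt_one (-1)
  have h2 : (fun t : ℝ => (t : ℂ) * f t) =o[atTop] fun _ : ℝ => (1 : ℝ) := by
    have h3 : (fun t : ℝ => (t : ℂ)) =O[atTop] fun t : ℝ => t :=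
      IsBigO.of_bound 1 (Filter.Eventually.of_forall fun t => by simp)
    refine (h3.mul_isLittleO (hf.trans_isLittleO h1)).congr' EventuallyEq.rfl ?_
    filter_upwards [eventually_gt_atTop 0] with t ht
    rw [Real.rpow_neg_one, mul_inv_cancel₀ ht.ne']
  refine ⟨(isLittleO_one_iff ℝ).1 h2, hf.trans_tendsto ?_⟩
  simpa using Real.tendsto_exp_neg_atTop_nhds_zero

theorem tendsto_iteratedLogTerm (n : ℕ) :
    Tendsto (iteratedLogTerm (n + 1)) atTop (𝓝 0) := by
  have h1 := (tendsto_zero_of_isBigO_exp (isBigO_atTop_blockSeries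
    (re_nonneg_of_mem_replicate (n := n + 1)) (by simp))).1
  have h2 : Tendsto (fun t => ∑ a ∈ Finset.range (n + 1), blockSeries
      (List.replicate a 1 ++ 2 :: List.replicate (n + 1 - 1 - a) 1) t) atTop
      (𝓝 (∑ a ∈ Finset.range (n + 1), 0)) :=
    tendsto_finsetSum _ fun a _ => (tendsto_zero_of_isBigO_exp (isBigO_atTop_blockSeries
      re_nonneg_of_mem_replicate_two (by simp))).2
  have h3 := h1.add h2
  simp only [Finset.sum_const_zero, add_zero] at h3
  exact h3

theorem eq_zero_of_hasDerivAt_zero {D : ℝ → ℂ} (hD : ∀ t : ℝ, 0 < t → HasDerivAt D 0 t)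
    (hlim : Tendsto D atTop (𝓝 0)) {t : ℝ} (ht : 0 < t) : D t = 0 := by
  have hconst : ∀ u : ℝ, 0 < u → D u = D t := fun u hu =>
    isOpen_Ioi.is_const_of_deriv_eq_zero isPreconnected_Ioi
      (fun x hx => (hD x hx).differentiableAt.differentiableWithinAt)
      (fun x hx => (hD x hx).deriv) hu ht
  refine tendsto_nhds_unique (tendsto_const_nhds.congr' ?_) hlim
  filter_upwards [eventually_gt_atTop 0] with u hu using (hconst u hu).symm

/-- In the induction both sides have the same derivative and the same limit `ζ(n + 2)` at infinity,
so their difference is a constant tending to `0`. -/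
theorem polylog_one_sub_exp_neg_eq (n : ℕ) : ∀ t : ℝ, 0 < t →
    polylog (n + 1) (1 - exp (-t)) =
      ∑ j ∈ Finset.range n, (-1) ^ j * riemannZeta ((n + 1 : ℕ) - j) *
        blockSeries (List.replicate j 1) t + (-1) ^ n * iteratedLogTerm n t := by
  induction n with
  | zero =>
    intro t ht
    simp [polylog_one_one_sub_exp_neg ht, iteratedLogTerm, blockSeries_nil]
  | succ n ih =>
    intro t ht
    refine sub_eq_zero.1 (eq_zero_of_hasDerivAt_zero (D := fun t : ℝ =>
      polylog (n + 1 + 1) (1 - exp (-t)) - (∑ j ∈ Finset.range (n + 1), (-1) ^ j *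
        riemannZeta ((n + 1 + 1 : ℕ) - j) * blockSeries (List.replicate j 1) t +
        (-1) ^ (n + 1) * iteratedLogTerm (n + 1) t)) (fun u hu => ?_) ?_ ht)
    · have h1 : HasDerivAt (fun t : ℝ => ∑ j ∈ Finset.range (n + 1), (-1) ^ j *
          riemannZeta ((n + 1 + 1 : ℕ) - j) * blockSeries (List.replicate j 1) t)
          (∑ j ∈ Finset.range n, (-1) ^ j * riemannZeta ((n + 1 : ℕ) - j) *
            (blockSeries (List.replicate j 1) u / (exp u - 1))) u := by
        -- The summand `j = 0` is the constant `ζ(n + 2)`; in the others the zeta argument depends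
        -- only on `n - j`, so the shifted sum differentiates to minus its predecessor over `e^t -
        -- 1`, the minus sign joining `(-1)^{j+1}`.
        simp only [Finset.sum_range_succ', List.replicate_zero, blockSeries_nil]
        refine (HasDerivAt.fun_sum fun j _ => ?_).add_const _
        convert! (hasDerivAt_blockSeries_replicate j hu).const_mul
          ((-1) ^ (j + 1) * riemannZeta ((n + 1 + 1 : ℕ) - (j + 1 : ℕ))) using 1
        rw [show ((n + 1 + 1 : ℕ) : ℂ) - (j + 1 : ℕ) = (n + 1 : ℕ) - j by push_cast; ring]
        ring
      have h2 := (hasDerivAt_polylog_one_sub_exp_neg (n + 1) hu).sub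
        (h1.add ((hasDerivAt_iteratedLogTerm n hu).const_mul ((-1) ^ (n + 1))))
      convert! h2 using 1
      rw [ih u hu, add_div, Finset.sum_div]
      simp only [mul_div_assoc]
      ring
    · have h1 : Tendsto (fun t : ℝ => ∑ j ∈ Finset.range (n + 1), (-1) ^ j *
          riemannZeta ((n + 1 + 1 : ℕ) - j) * blockSeries (List.replicate j 1) t) atTop
          (𝓝 (∑ j ∈ Finset.range n, (-1) ^ (j + 1) *
            riemannZeta ((n + 1 + 1 : ℕ) - (j + 1 : ℕ)) * 0 + riemannZeta (n + 1 + 1 : ℕ))) := by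
        simp only [Finset.sum_range_succ', List.replicate_zero, blockSeries_nil]
        refine (tendsto_finsetSum _ fun j _ => ?_).add (by simp)
        exact (tendsto_zero_of_isBigO_exp (isBigO_atTop_blockSeries
          re_nonneg_of_mem_replicate (by simp))).2.const_mul _
      have h2 := (tendsto_polylog_one_sub_exp_neg (k := n + 1 + 1) (by omega)).sub
        (h1.add ((tendsto_iteratedLogTerm n).const_mul ((-1) ^ (n + 1))))
      simpa using h2

theorem polylog_one_sub_exp_neg_eq_sum {k : ℕ} (hk : 2 ≤ k) {t : ℝ} (ht : 0 < t) :
    polylog k (1 - exp (-t)) = ∑ j ∈ Finset.Icc 0 (2 * k - 2),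
      coeffA j k * (t : ℂ) ^ (if j + 1 = k then 1 else 0) * blockSeries (block j k) t := by
  obtain ⟨n, rfl⟩ : ∃ n, k = n + 1 := ⟨k - 1, by omega⟩
  -- The range splits into `j < n` (zeta terms), `j = n` (the term with `t`) and `j = n + 1 + a`, `a
  -- < n` (blocks containing a `2`).
  have hI : Finset.Icc 0 (2 * (n + 1) - 2) = Finset.range (n + (1 + n)) := by
    ext j
    simp only [Finset.mem_Icc, Finset.mem_range]
    omega
  rw [hI, Finset.sum_range_add, Finset.sum_range_add, polylog_one_sub_exp_neg_eq n t ht]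
  congr 1
  · refine Finset.sum_congr rfl fun j hj => ?_
    have hj' := Finset.mem_range.1 hj
    simp [coeffA, block, hj', hj'.ne, show j < n + 1 by omega]
  · rw [iteratedLogTerm, mul_add, Finset.mul_sum]
    congr 1
    · simp [coeffA, block]
      ring
    · refine Finset.sum_congr rfl fun a ha => ?_
      have ha' := Finset.mem_range.1 ha
      simp [coeffA, block, show ¬ (n + (1 + a) < n) by omega, show ¬ (n + (1 + a) < n + 1) by omega,
        show n + (1 + a) - (n + 1) = a by omega,
        show 2 * (n + 1) - 2 - (n + (1 + a)) = n - 1 - a by omega]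

/-! ### Mordell-Tornheim series as Mellin transforms of products of block series. -/

/-- The coefficient of a generalized Mordell-Tornheim series, without its last argument. -/
noncomputable def gmtCoeff {r : ℕ} (S : Fin r → List ℂ)
    (m : (i : Fin r) → Fin (S i).length → ℕ+) : ℂ :=
  ∏ i, tupleCoeff (S i).get (m i)

/-- The sum of all the summation variables. -/
noncomputable def gmtSize {r : ℕ} {n : Fin r → ℕ} (m : (i : Fin r) → Fin (n i) → ℕ+) : ℝ :=
  ∑ i, tupleSize (m i)

/-- The product of the series attached to the blocks. -/
noncomputable def gmtTheta {r : ℕ} (S : Fin r → List ℂ) (t : ℝ) : ℂ := ∏ i, blockSeries (S i) t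

theorem gmtTerm_eq {r : ℕ} (S : Fin r → List ℂ) (s : ℂ)
    (m : (i : Fin r) → Fin (S i).length → ℕ+) :
    gmtTerm S s m = gmtCoeff S m / (gmtSize m : ℂ) ^ s := by
  have h : ((gmtSize m : ℝ) : ℂ) = ∑ i, ∑ q, (m i q : ℂ) := by
    simp [gmtSize, tupleSize]
  rw [gmtTerm, gmtCoeff, h, ← div_div]
  simp [tupleCoeff]

theorem summable_norm_gmt_exp {r : ℕ} {S : Fin r → List ℂ} (hS : ∀ i, ∀ x ∈ S i, 0 ≤ x.re)
    {t : ℝ} (ht : 0 < t) :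
    (Summable fun m => ‖gmtCoeff S m‖ * Real.exp (-gmtSize m * t)) ∧
      ∑' m, gmtCoeff S m * (Real.exp (-gmtSize m * t) : ℂ) = gmtTheta S t := by
  have h := summable_norm_and_tsum_pi_prod
    (fun i (m : Fin (S i).length → ℕ+) =>
      tupleCoeff (S i).get m * (Real.exp (-tupleSize m * t) : ℂ)) fun i => by
    simpa only [norm_mul, norm_real, Real.norm_of_nonneg (Real.exp_pos _).le] using
      summable_norm_tupleSeries (fun q => hS i _ (List.get_mem _ q)) ht
  have h1 : ∀ m : (i : Fin r) → Fin (S i).length → ℕ+,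
      ∏ i, tupleCoeff (S i).get (m i) * (Real.exp (-tupleSize (m i) * t) : ℂ) =
        gmtCoeff S m * (Real.exp (-gmtSize m * t) : ℂ) := fun m => by
    rw [Finset.prod_mul_distrib, gmtCoeff, gmtSize, ← ofReal_prod, ← Real.exp_sum,
      ← Finset.sum_mul, Finset.sum_neg_distrib]
  simp only [h1] at h
  refine ⟨?_, h.2⟩
  simpa only [norm_mul, norm_real, Real.norm_of_nonneg (Real.exp_pos _).le] using h.1

theorem hasSum_gmtTheta {r : ℕ} {S : Fin r → List ℂ} (hS : ∀ i, ∀ x ∈ S i, 0 ≤ x.re)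
    {t : ℝ} (ht : 0 < t) :
    HasSum (fun m => gmtCoeff S m * (Real.exp (-gmtSize m * t) : ℂ)) (gmtTheta S t) := by
  obtain ⟨h1, h2⟩ := summable_norm_gmt_exp hS ht
  rw [← h2]
  refine Summable.hasSum (Summable.of_norm ?_)
  simpa only [norm_mul, norm_real, Real.norm_of_nonneg (Real.exp_pos _).le] using h1

/-- The shape of the blocks to be considered: the first one is `(0)`, and the others have entries
`1` and `2`. -/
def IsBlockFamily {r : ℕ} (S : Fin (r + 1) → List ℂ) : Prop :=
  S 0 = [0] ∧ ∀ i : Fin r, ∀ x ∈ S i.succ, x = 1 ∨ x = 2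

theorem IsBlockFamily.re_nonneg {r : ℕ} {S : Fin (r + 1) → List ℂ} (hS : IsBlockFamily S) :
    ∀ i, ∀ x ∈ S i, 0 ≤ x.re := by
  intro i
  refine Fin.cases ?_ (fun i x hx => ?_) i
  · rw [hS.1]
    simp
  · rcases hS.2 i x hx with rfl | rfl <;> simp

theorem prod_eq_tupleSize {n : ℕ} (hn : n = 1) (m : Fin n → ℕ+) :
    ∏ q, (m q : ℝ) = tupleSize m := by
  subst hn
  simp [tupleSize]

theorem tupleSize_le_gmtSize {r : ℕ} {n : Fin r → ℕ} (m : (i : Fin r) → Fin (n i) → ℕ+)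
    (i : Fin r) : tupleSize (m i) ≤ gmtSize m :=
  Finset.single_le_sum (f := fun i => tupleSize (m i)) (fun _ _ => tupleSize_nonneg _)
    (Finset.mem_univ i)

theorem IsBlockFamily.one_le_gmtSize {r : ℕ} {S : Fin (r + 1) → List ℂ} (hS : IsBlockFamily S)
    (m : (i : Fin (r + 1)) → Fin (S i).length → ℕ+) : 1 ≤ gmtSize m :=
  (one_le_tupleSize (by rw [hS.1]; simp) (m 0)).trans (tupleSize_le_gmtSize m 0)

theorem norm_tupleCoeff_le_inv_prod {n : ℕ} {e : Fin n → ℂ} (he : ∀ q, 1 ≤ (e q).re)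
    (m : Fin n → ℕ+) : ‖tupleCoeff e m‖ ≤ (∏ q, (m q : ℝ))⁻¹ := by
  rw [tupleCoeff, norm_div, norm_one, norm_prod, one_div]
  have h0 : ∀ q, (0 : ℝ) < m q := fun q => zero_lt_one.trans_le (one_le_cast_pnat _)
  refine inv_anti₀ (Finset.prod_pos fun q _ => h0 q)
    (Finset.prod_le_prod (fun q _ => (h0 q).le) fun q _ => ?_)
  rw [norm_partialSum_cpow]
  have h1 := le_partialSum m q
  exact h1.trans (Real.self_le_rpow_of_one_le ((one_le_cast_pnat _).trans h1) (he q))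

/-- The block `(0)` gives no decay in its variable; one factor of the total size is spent to supply
the missing reciprocal. -/
theorem IsBlockFamily.norm_gmtCoeff_le {r : ℕ} {S : Fin (r + 1) → List ℂ} (hS : IsBlockFamily S)
    (m : (i : Fin (r + 1)) → Fin (S i).length → ℕ+) :
    ‖gmtCoeff S m‖ ≤ gmtSize m * ∏ i, (∏ q, (m i q : ℝ))⁻¹ := by
  have h0 : ∀ i, (0 : ℝ) < ∏ q, (m i q : ℝ) := fun i =>
    Finset.prod_pos fun q _ => zero_lt_one.trans_le (one_le_cast_pnat _)
  rw [gmtCoeff, norm_prod, Fin.prod_univ_succ, Fin.prod_univ_succ, ← mul_assoc]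
  refine mul_le_mul ?_ (Finset.prod_le_prod (fun _ _ => norm_nonneg _) fun i _ => ?_)
    (Finset.prod_nonneg fun _ _ => norm_nonneg _) ?_
  · refine (norm_tupleCoeff_le_one (fun q => hS.re_nonneg 0 _ (List.get_mem _ q)) _).trans ?_
    rw [← div_eq_mul_inv, one_le_div (h0 0), prod_eq_tupleSize (by rw [hS.1]; simp)]
    exact tupleSize_le_gmtSize m 0
  · refine norm_tupleCoeff_le_inv_prod (fun q => ?_) _
    rcases hS.2 i _ (List.get_mem _ q) with h | h <;> rw [h] <;> simp
  · exact mul_nonneg (zero_le_one.trans (hS.one_le_gmtSize m)) (inv_nonneg.2 (h0 0).le)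

theorem IsBlockFamily.summable {r : ℕ} {S : Fin (r + 1) → List ℂ} (hS : IsBlockFamily S)
    {σ : ℝ} (hσ : 1 < σ) : Summable fun m => ‖gmtCoeff S m‖ / gmtSize m ^ σ := by
  set C : ℕ := ∑ i, (S i).length with hC
  have hC0 : 0 < C := by
    rw [hC, Fin.sum_univ_succ, hS.1]
    simp
  have hC0' : (0 : ℝ) < C := Nat.cast_pos.2 hC0
  -- The excess `σ - 1` is shared equally among the `C` variables. Each is at most the total size,
  -- so the series is dominated by a product of sums `∑ m ^ (-(1 + β))`.
  set β : ℝ := (σ - 1) / C with hβ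
  have hβ0 : 0 < β := div_pos (sub_pos.2 hσ) hC0'
  have hone : Summable fun m : ℕ+ => (m : ℝ) ^ (-(1 + β)) :=
    (Real.summable_nat_rpow.2 (by linarith)).comp_injective PNat.coe_injective
  have hblock : ∀ i : Fin (r + 1), Summable fun m : Fin (S i).length → ℕ+ =>
      ‖∏ q, (m q : ℝ) ^ (-(1 + β))‖ := fun i =>
    (summable_norm_and_tsum_pi_prod (fun (_ : Fin (S i).length) (m : ℕ+) => (m : ℝ) ^ (-(1 + β)))
      fun _ => hone.norm).1
  refine ((summable_norm_and_tsum_pi_prod (fun i (m : Fin (S i).length → ℕ+) =>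
    ∏ q, (m q : ℝ) ^ (-(1 + β))) hblock).1).of_nonneg_of_le (fun m => ?_) fun m => ?_
  · exact div_nonneg (norm_nonneg _)
      (Real.rpow_nonneg (zero_le_one.trans (hS.one_le_gmtSize m)) _)
  have h1 := hS.one_le_gmtSize m
  have hpos : 0 < gmtSize m := zero_lt_one.trans_le h1
  have hm0 : ∀ i q, (0 : ℝ) < m i q := fun i q => zero_lt_one.trans_le (one_le_cast_pnat _)
  have hpow : ∏ i, ∏ q, (m i q : ℝ) ^ β ≤ gmtSize m ^ (σ - 1) := by
    have h2 : gmtSize m ^ (σ - 1) = ∏ i : Fin (r + 1), ∏ _q : Fin (S i).length, gmtSize m ^ β := by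
      simp only [Finset.prod_const, Finset.card_univ, Fintype.card_fin]
      rw [Finset.prod_pow_eq_pow_sum, ← hC, ← Real.rpow_natCast, ← Real.rpow_mul hpos.le, hβ,
        div_mul_cancel₀ _ hC0'.ne']
    rw [h2]
    refine Finset.prod_le_prod (fun i _ => Finset.prod_nonneg fun q _ =>
      Real.rpow_nonneg (hm0 i q).le _) fun i _ => Finset.prod_le_prod (fun q _ =>
      Real.rpow_nonneg (hm0 i q).le _) fun q _ => ?_
    refine Real.rpow_le_rpow (hm0 i q).le (le_trans ?_ (tupleSize_le_gmtSize m i)) hβ0.le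
    exact Finset.single_le_sum (f := fun q => (m i q : ℝ)) (fun _ _ => Nat.cast_nonneg _)
      (Finset.mem_univ q)
  have hprod0 : 0 < ∏ i, ∏ q, (m i q : ℝ) ^ β :=
    Finset.prod_pos fun i _ => Finset.prod_pos fun q _ => Real.rpow_pos_of_pos (hm0 i q) _
  refine le_trans ?_ (Real.le_norm_self _)
  have h3 : ∏ i, ∏ q, (m i q : ℝ) ^ (-(1 + β)) =
      (∏ i, (∏ q, (m i q : ℝ))⁻¹) / ∏ i, ∏ q, (m i q : ℝ) ^ β := by
    rw [← Finset.prod_div_distrib]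
    refine Finset.prod_congr rfl fun i _ => ?_
    rw [← Finset.prod_inv_distrib, ← Finset.prod_div_distrib]
    refine Finset.prod_congr rfl fun q _ => ?_
    rw [Real.rpow_neg (hm0 i q).le, Real.rpow_add (hm0 i q), Real.rpow_one, mul_inv, div_eq_mul_inv]
  have hinv : 0 ≤ ∏ i, (∏ q, (m i q : ℝ))⁻¹ :=
    Finset.prod_nonneg fun i _ => inv_nonneg.2 (Finset.prod_nonneg fun q _ => (hm0 i q).le)
  have h4 : gmtSize m ^ σ = gmtSize m * gmtSize m ^ (σ - 1) := by
    rw [← Real.rpow_one_add' hpos.le (by linarith)]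
    congr 1
    ring
  rw [h3, h4]
  calc ‖gmtCoeff S m‖ / (gmtSize m * gmtSize m ^ (σ - 1))
      ≤ (gmtSize m * ∏ i, (∏ q, (m i q : ℝ))⁻¹) / (gmtSize m * gmtSize m ^ (σ - 1)) := by
        gcongr
        exact hS.norm_gmtCoeff_le m
    _ = (∏ i, (∏ q, (m i q : ℝ))⁻¹) / gmtSize m ^ (σ - 1) := by
        rw [mul_div_mul_left _ _ hpos.ne']
    _ ≤ _ := by gcongr

theorem IsBlockFamily.summable_gmtTerm {r : ℕ} {S : Fin (r + 1) → List ℂ} (hS : IsBlockFamily S)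
    {s : ℂ} (hs : 1 < s.re) : Summable (gmtTerm S s) := by
  refine Summable.of_norm ((hS.summable hs).congr fun m => ?_)
  rw [gmtTerm_eq, norm_div, norm_cpow_eq_rpow_re_of_pos
    (zero_lt_one.trans_le (hS.one_le_gmtSize m))]

theorem exp_neg_le_rpow {σ x : ℝ} (hσ : 0 < σ) (hx : 0 < x) :
    Real.exp (-x) ≤ σ ^ σ * x ^ (-σ) := by
  -- Raising `y ≤ e^y` to the power `σ` at `y = x / σ` produces the constant `σ ^ σ`.
  have h1 : x / σ ≤ Real.exp (x / σ) := by linarith [Real.add_one_le_exp (x / σ)]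
  have h2 : (x / σ) ^ σ ≤ Real.exp x := by
    refine (Real.rpow_le_rpow (by positivity) h1 hσ.le).trans_eq ?_
    rw [← Real.exp_mul, div_mul_cancel₀ _ hσ.ne']
  rw [Real.div_rpow hx.le hσ.le] at h2
  rw [Real.exp_neg, Real.rpow_neg hx.le, ← div_eq_mul_inv, ← inv_div]
  exact inv_anti₀ (by positivity) h2

/-- Termwise comparison with the convergent series at `σ`. The bound holds for every `σ > 1`, which
puts the whole half-plane `Re s > 1` within the convergence range. -/
theorem IsBlockFamily.isBigO_gmtTheta {r : ℕ} {S : Fin (r + 1) → List ℂ} (hS : IsBlockFamily S)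
    {σ : ℝ} (hσ : 1 < σ) : gmtTheta S =O[𝓝[>] 0] fun t : ℝ => t ^ (-σ) := by
  have hσ0 : 0 < σ := zero_lt_one.trans hσ
  refine IsBigO.of_bound (σ ^ σ * ∑' m, ‖gmtCoeff S m‖ / gmtSize m ^ σ) ?_
  filter_upwards [self_mem_nhdsWithin] with t ht
  have ht' : 0 < t := ht
  rw [← (hasSum_gmtTheta hS.re_nonneg ht').tsum_eq,
    Real.norm_of_nonneg (Real.rpow_nonneg ht'.le _)]
  refine tsum_of_norm_bounded (((hS.summable hσ).hasSum.mul_left _).mul_right _) fun m => ?_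
  have hpos : 0 < gmtSize m := zero_lt_one.trans_le (hS.one_le_gmtSize m)
  rw [norm_mul, norm_real, Real.norm_of_nonneg (Real.exp_pos _).le, neg_mul]
  refine (mul_le_mul_of_nonneg_left (exp_neg_le_rpow hσ0 (mul_pos hpos ht'))
    (norm_nonneg _)).trans_eq ?_
  rw [Real.mul_rpow hpos.le ht'.le, Real.rpow_neg hpos.le]
  ring

theorem continuousOn_blockSeries {S : List ℂ} (hS : ∀ x ∈ S, 0 ≤ x.re) :
    ContinuousOn (blockSeries S) (Ioi 0) := fun _ ht =>
  (hasDerivAt_dirichlet (fun m => tupleSize_nonneg m)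
    (fun _ hu => summable_norm_tupleSeries (fun q => hS _ (List.get_mem _ q)) hu)
    ht).continuousAt.continuousWithinAt

theorem continuousOn_gmtTheta {r : ℕ} {S : Fin r → List ℂ} (hS : ∀ i, ∀ x ∈ S i, 0 ≤ x.re) :
    ContinuousOn (gmtTheta S) (Ioi 0) :=
  continuousOn_finsetProd _ fun i _ => continuousOn_blockSeries (hS i)

theorem IsBlockFamily.isBigO_atTop_gmtTheta {r : ℕ} {S : Fin (r + 1) → List ℂ}
    (hS : IsBlockFamily S) : gmtTheta S =O[atTop] fun t => Real.exp (-1 * t) := by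
  refine (isBigO_atTop_dirichlet (c := gmtCoeff S) (p := gmtSize) hS.one_le_gmtSize
    (summable_norm_gmt_exp hS.re_nonneg zero_lt_one).1).congr' ?_ EventuallyEq.rfl
  filter_upwards [eventually_gt_atTop 0] with t ht
  exact (hasSum_gmtTheta hS.re_nonneg ht).tsum_eq

theorem blockSeries_singleton_zero {t : ℝ} (ht : 0 < t) :
    blockSeries [0] t = 1 / (exp t - 1) := by
  have h := blockSeries_append_zero (S := []) (by simp) ht
  rwa [List.nil_append, blockSeries_nil] at h

theorem HasLogExpansion.prod {ι : Type*} {A : Finset ι} {f : ι → ℝ → ℂ}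
    (hf : ∀ i ∈ A, HasLogExpansion (f i)) : HasLogExpansion (∏ i ∈ A, f i) :=
  Finset.prod_induction _ _ (fun _ _ => HasLogExpansion.mul) hasLogExpansion_one hf

theorem IsBlockFamily.hasLogExpansion_gmtTheta {r : ℕ} {S : Fin (r + 1) → List ℂ}
    (hS : IsBlockFamily S) : HasLogExpansion (gmtTheta S) := by
  refine (HasLogExpansion.prod (A := Finset.univ) (f := fun i => blockSeries (S i))
    fun i _ => ?_).congr (Filter.Eventually.of_forall fun t => by simp [gmtTheta])
  refine Fin.cases ?_ (fun i => hasLogExpansion_blockSeries (hS.2 i)) i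
  rw [hS.1]
  refine hasLogExpansion_inv_exp_sub_one.congr ?_
  filter_upwards [self_mem_nhdsWithin] with t ht
  exact (blockSeries_singleton_zero ht).symm

theorem IsBlockFamily.locallyIntegrableOn {r : ℕ} {S : Fin (r + 1) → List ℂ}
    (hS : IsBlockFamily S) : LocallyIntegrableOn (gmtTheta S) (Ioi 0) :=
  (continuousOn_gmtTheta hS.re_nonneg).locallyIntegrableOn measurableSet_Ioi

theorem IsBlockFamily.mellinConvergent {r : ℕ} {S : Fin (r + 1) → List ℂ}
    (hS : IsBlockFamily S) {s : ℂ} (hs : 1 < s.re) : MellinConvergent (gmtTheta S) s := by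
  obtain ⟨b, hb1, hb2⟩ := exists_between hs
  exact mellinConvergent_of_isBigO_rpow_exp zero_lt_one hS.locallyIntegrableOn
    hS.isBigO_atTop_gmtTheta (hS.isBigO_gmtTheta hb1) hb2

theorem IsBlockFamily.differentiableOn_mellin {r : ℕ} {S : Fin (r + 1) → List ℂ}
    (hS : IsBlockFamily S) : DifferentiableOn ℂ (mellin (gmtTheta S)) {s | 1 < s.re} := by
  intro s hs
  obtain ⟨b, hb1, hb2⟩ := exists_between (show 1 < s.re from hs)
  exact (mellin_differentiableAt_of_isBigO_rpow_exp zero_lt_one hS.locallyIntegrableOn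
    hS.isBigO_atTop_gmtTheta (hS.isBigO_gmtTheta hb1) hb2).differentiableWithinAt

theorem IsBlockFamily.mellin_gmtTheta {r : ℕ} {S : Fin (r + 1) → List ℂ}
    (hS : IsBlockFamily S) {s : ℂ} (hs : 1 < s.re) :
    mellin (gmtTheta S) s = Gamma s * gmtSeries S s := by
  have h := hasSum_mellin (a := gmtCoeff S) (p := gmtSize) (F := gmtTheta S) (s := s)
    (fun m => Or.inr (zero_lt_one.trans_le (hS.one_le_gmtSize m))) (by linarith)
    (fun t ht => hasSum_gmtTheta hS.re_nonneg ht) (hS.summable hs)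
  rw [← h.tsum_eq, gmtSeries, ← tsum_mul_left]
  refine tsum_congr fun m => ?_
  rw [gmtTerm_eq, mul_div_assoc]

theorem meromorphicContinuation_eq {f F : ℂ → ℂ} (h : IsMeromorphicContinuation f F) :
    meromorphicContinuation f = F := by
  have hex : ∃ F, IsMeromorphicContinuation f F := ⟨F, h⟩
  rw [meromorphicContinuation, dif_pos hex]
  exact hex.choose_spec.unique h

/-- For `Re s > 1` the series is the Mellin transform divided by `Γ`; the transform continues
meromorphically and `1 / Γ` is entire. -/
theorem IsBlockFamily.gmtZeta_spec {r : ℕ} {S : Fin (r + 1) → List ℂ} (hS : IsBlockFamily S) :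
    MeromorphicNFOn (gmtZeta S) univ ∧ ∀ s : ℂ, 1 < s.re → gmtZeta S s = gmtSeries S s := by
  obtain ⟨F, hF, hFm⟩ := exists_meromorphicNFOn_mellin zero_lt_one hS.locallyIntegrableOn
    hS.isBigO_atTop_gmtTheta hS.hasLogExpansion_gmtTheta hS.differentiableOn_mellin
  have hΓ : Differentiable ℂ fun s : ℂ => (Gamma s)⁻¹ := differentiable_one_div_Gamma
  have hm : MeromorphicOn (fun s => (Gamma s)⁻¹ * F s) univ := fun s hs =>
    (hΓ.analyticAt s).meromorphicAt.mul (hF.meromorphicOn s hs)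
  have hval : ∀ s : ℂ, 1 < s.re →
      toMeromorphicNFOn (fun s => (Gamma s)⁻¹ * F s) univ s = gmtSeries S s := by
    intro s hs
    rw [toMeromorphicNFOn_apply_of_analyticAt hm (mem_univ s), hFm s hs, hS.mellin_gmtTheta hs,
      inv_mul_cancel_left₀ (Gamma_ne_zero_of_re_pos (zero_lt_one.trans hs))]
    refine (hΓ.analyticAt s).mul ((hS.differentiableOn_mellin.analyticAt
      ((isOpen_halfPlane 1).mem_nhds hs)).congr ?_)
    filter_upwards [(isOpen_halfPlane 1).mem_nhds hs] with z hz using (hFm z hz).symm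
  have hcont : gmtZeta S = toMeromorphicNFOn (fun s => (Gamma s)⁻¹ * F s) univ :=
    meromorphicContinuation_eq ⟨meromorphicNFOn_toMeromorphicNFOn _ _, 1, hval⟩
  rw [hcont]
  exact ⟨meromorphicNFOn_toMeromorphicNFOn _ _, hval⟩

theorem isBlockFamily_blocks {r : ℕ} (j k : Fin r → ℕ) : IsBlockFamily (blocks j k) := by
  refine ⟨by simp [blocks], fun i x hx => ?_⟩
  simp only [blocks, Fin.cons_succ, block] at hx
  split_ifs at hx
  · exact Or.inl (List.eq_of_mem_replicate hx)
  · simp only [List.mem_append, List.mem_cons, List.mem_replicate] at hx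
    rcases hx with ⟨_, rfl⟩ | rfl | ⟨_, rfl⟩ <;> simp

/-! ### The Ito kernel: order at `0`, expansion and entire continuation. -/

/-- The integrand of the Ito zeta function without the factor `t ^ (s - 1)`. -/
noncomputable def itoKernel (K : List ℕ) (t : ℝ) : ℂ :=
  (K.map fun κ => polylog κ (1 - exp (-t))).prod / (exp t - 1)

theorem itoIntegral_eq_mellin (K : List ℕ) (s : ℂ) :
    itoIntegral K s = (Gamma s)⁻¹ * mellin (itoKernel K) s := by
  rw [itoIntegral, one_div]
  rfl

theorem exists_analyticAt_polylog_one_sub_exp_neg (κ : ℕ) :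
    ∃ g : ℂ → ℂ, AnalyticAt ℂ g 0 ∧ ∀ z : ℂ, polylog κ (1 - exp (-z)) = z * g z := by
  have h1 : AnalyticAt ℂ (fun z : ℂ => 1 - exp (-z)) 0 := by fun_prop
  have h2 : AnalyticAt ℂ (fun z : ℂ => polylog κ (1 - exp (-z))) 0 :=
    AnalyticAt.fun_comp (g := polylog κ) (by simpa using analyticAt_polylog κ) h1
  obtain ⟨p, hp⟩ := h2
  refine ⟨_, ⟨_, hp.has_fpower_series_dslope_fslope⟩, fun z => ?_⟩
  have h3 := sub_smul_dslope (fun z : ℂ => polylog κ (1 - exp (-z))) 0 z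
  simpa [polylog_zero_right] using h3.symm

theorem exists_analyticAt_prod_polylog (K : List ℕ) :
    ∃ g : ℂ → ℂ, AnalyticAt ℂ g 0 ∧
      ∀ z : ℂ, (K.map fun κ => polylog κ (1 - exp (-z))).prod = z ^ K.length * g z := by
  induction K with
  | nil => exact ⟨fun _ => 1, analyticAt_const, fun z => by simp⟩
  | cons κ K ih =>
    obtain ⟨g, hg, h⟩ := ih
    obtain ⟨g', hg', h'⟩ := exists_analyticAt_polylog_one_sub_exp_neg κ
    refine ⟨fun z => g' z * g z, hg'.mul hg, fun z => ?_⟩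
    rw [List.map_cons, List.prod_cons, h, h', List.length_cons, pow_succ]
    ring

/-- Each polylogarithm factor vanishes at `t = 0` and `1 / (e^t - 1)` has a simple pole there; the
resulting order gives the abscissa `1 - (l + r)`. -/
theorem exists_analyticAt_itoKernel (K : List ℕ) (hK : 0 < K.length) :
    ∃ g : ℂ → ℂ, AnalyticAt ℂ g 0 ∧
      ∀ t : ℝ, 0 < t → itoKernel K t = (t : ℂ) ^ (K.length - 1) * g t := by
  obtain ⟨g, hg, h⟩ := exists_analyticAt_prod_polylog K
  obtain ⟨g', hg', h'⟩ := exists_analyticAt_exp_sub_one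
  refine ⟨fun z => g z * g' z, hg.mul hg', fun t ht => ?_⟩
  have ht' : (t : ℂ) ≠ 0 := ofReal_ne_zero.2 ht.ne'
  rw [itoKernel, div_eq_mul_one_div, h, h' _ ht']
  obtain ⟨n, hn⟩ : ∃ n, K.length = n + 1 := ⟨K.length - 1, by omega⟩
  rw [hn, Nat.add_sub_cancel, pow_succ]
  field_simp

/-- The `l` factors `Li_1` give `t ^ l`; the product of the other expansions is distributed over
sums. The exponent is cast to `ℂ` to match the shift rule of the Mellin transform. -/
theorem itoKernel_eq_sum {l r : ℕ} {k : Fin r → ℕ} (hk : ∀ i, 2 ≤ k i) {t : ℝ} (ht : 0 < t) :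
    itoKernel (List.replicate l 1 ++ List.ofFn k) t = ∑ j ∈ indexRange k,
      prodA j k * ((t : ℂ) ^ ((l + countB j k : ℕ) : ℂ) * gmtTheta (blocks j k) t) := by
  have h1 : ((List.replicate l 1 ++ List.ofFn k).map fun κ => polylog κ (1 - exp (-t))).prod =
      (t : ℂ) ^ l * ∏ i, polylog (k i) (1 - exp (-t)) := by
    rw [List.map_append, List.prod_append, List.map_replicate, List.prod_replicate,
      polylog_one_one_sub_exp_neg ht, List.map_ofFn, List.prod_ofFn]
    rfl
  have h2 : ∏ i, polylog (k i) (1 - exp (-t)) = ∑ j ∈ indexRange k, ∏ i,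
      coeffA (j i) (k i) * (t : ℂ) ^ (if j i + 1 = k i then 1 else 0) *
        blockSeries (block (j i) (k i)) t := by
    rw [Finset.prod_congr rfl fun i _ => polylog_one_sub_exp_neg_eq_sum (hk i) ht]
    exact Finset.prod_univ_sum _ _
  rw [itoKernel, h1, h2, div_eq_mul_one_div, ← blockSeries_singleton_zero ht, Finset.mul_sum,
    Finset.sum_mul]
  refine Finset.sum_congr rfl fun j _ => ?_
  have h3 : gmtTheta (blocks j k) t =
      blockSeries [0] t * ∏ i, blockSeries (block (j i) (k i)) t := by
    simp [gmtTheta, blocks, Fin.prod_univ_succ]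
  have h4 : ∏ i, (t : ℂ) ^ (if j i + 1 = k i then 1 else 0) = (t : ℂ) ^ countB j k := by
    rw [Finset.prod_pow_eq_pow_sum, countB, Finset.card_filter]
  rw [h3, Finset.prod_mul_distrib, Finset.prod_mul_distrib, h4, prodA, cpow_natCast, pow_add]
  ring

theorem isBigO_pow_mul_exp (n : ℕ) {f : ℝ → ℂ}
    (hf : f =O[atTop] fun t => Real.exp (-1 * t)) :
    (fun t : ℝ => (t : ℂ) ^ (n : ℂ) * f t) =O[atTop] fun t => Real.exp (-(1 / 2) * t) := by
  have h1 : (fun t : ℝ => (t : ℂ) ^ (n : ℂ)) =O[atTop] fun t : ℝ => Real.exp (1 / 2 * t) := by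
    refine (IsBigO.of_bound 1 (Filter.Eventually.of_forall fun t => ?_)).trans
      (isLittleO_pow_exp_pos_mul_atTop (k := n) (b := 1 / 2) (by norm_num)).isBigO
    simp
  refine (h1.mul hf).congr_right fun t => ?_
  rw [← Real.exp_add]
  congr 1
  ring

section

variable {l r : ℕ} {k : Fin r → ℕ}

/-- Decay is read off the finite expansion; half of the exponential rate absorbs the powers of `t`.
-/
theorem isBigO_atTop_itoKernel (hk : ∀ i, 2 ≤ k i) :
    itoKernel (List.replicate l 1 ++ List.ofFn k) =O[atTop]
      fun t => Real.exp (-(1 / 2) * t) := by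
  have h : (fun t : ℝ => ∑ j ∈ indexRange k, prodA j k *
      ((t : ℂ) ^ ((l + countB j k : ℕ) : ℂ) * gmtTheta (blocks j k) t)) =O[atTop]
      fun t => Real.exp (-(1 / 2) * t) :=
    IsBigO.fun_sum fun j _ => (isBigO_pow_mul_exp _
      (isBlockFamily_blocks j k).isBigO_atTop_gmtTheta).const_mul_left _
  refine h.congr' ?_ EventuallyEq.rfl
  filter_upwards [eventually_gt_atTop 0] with t ht using (itoKernel_eq_sum hk ht).symm

theorem locallyIntegrableOn_itoKernel (hk : ∀ i, 2 ≤ k i) :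
    LocallyIntegrableOn (itoKernel (List.replicate l 1 ++ List.ofFn k)) (Ioi 0) := by
  refine ContinuousOn.locallyIntegrableOn ?_ measurableSet_Ioi
  refine ContinuousOn.congr ?_ fun t ht => itoKernel_eq_sum hk ht
  refine continuousOn_finsetSum _ fun j _ => continuousOn_const.mul (ContinuousOn.mul ?_
    (continuousOn_gmtTheta (isBlockFamily_blocks j k).re_nonneg))
  simp only [cpow_natCast]
  fun_prop

theorem length_replicate_append_ofFn :
    (List.replicate l 1 ++ List.ofFn k).length = l + r := by simp

theorem isBigO_zero_itoKernel (hr : 0 < r) :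
    itoKernel (List.replicate l 1 ++ List.ofFn k) =O[𝓝[>] 0]
      fun t : ℝ => t ^ (-(1 - ((l : ℝ) + r))) := by
  obtain ⟨g, hg, h⟩ := exists_analyticAt_itoKernel (List.replicate l 1 ++ List.ofFn k)
    (by rw [length_replicate_append_ofFn]; omega)
  have hg1 : (fun t : ℝ => g t) =O[𝓝[>] 0] fun _ : ℝ => (1 : ℝ) :=
    (hg.continuousAt.tendsto.comp (show Tendsto (fun t : ℝ => (t : ℂ)) (𝓝[>] 0) (𝓝 0) from
      (continuous_ofReal.tendsto' 0 0 ofReal_zero).mono_left nhdsWithin_le_nhds)).isBigO_one ℝ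
  have hp : (fun t : ℝ => (t : ℂ) ^ (l + r - 1)) =O[𝓝[>] 0] fun t : ℝ => t ^ (l + r - 1) :=
    IsBigO.of_bound 1 (Filter.Eventually.of_forall fun t => by simp)
  refine (hp.mul hg1).congr' ?_ ?_
  · filter_upwards [self_mem_nhdsWithin] with t ht
    rw [h t ht, length_replicate_append_ofFn]
  · refine Filter.Eventually.of_forall fun t => ?_
    dsimp only
    rw [mul_one, ← Real.rpow_natCast]
    congr 1
    rw [Nat.cast_sub (by omega)]
    push_cast
    ring

theorem mellinConvergent_itoKernel (hr : 0 < r) (hk : ∀ i, 2 ≤ k i) {s : ℂ}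
    (hs : 1 - ((l : ℝ) + r) < s.re) :
    MellinConvergent (itoKernel (List.replicate l 1 ++ List.ofFn k)) s :=
  mellinConvergent_of_isBigO_rpow_exp (by norm_num) (locallyIntegrableOn_itoKernel hk)
    (isBigO_atTop_itoKernel hk) (isBigO_zero_itoKernel hr) hs

/-- Unlike the single block series, the kernel extends analytically to `0`, so `1 / Γ(s)` removes
every pole of its Mellin transform. -/
theorem xiMT_spec (hr : 0 < r) (hk : ∀ i, 2 ≤ k i) :
    Differentiable ℂ (xiMT (List.replicate l 1 ++ List.ofFn k)) ∧
      ∀ s : ℂ, 1 - ((l : ℝ) + r) < s.re →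
        xiMT (List.replicate l 1 ++ List.ofFn k) s =
          itoIntegral (List.replicate l 1 ++ List.ofFn k) s := by
  obtain ⟨g, hg, h⟩ := exists_analyticAt_itoKernel (List.replicate l 1 ++ List.ofFn k)
    (by rw [length_replicate_append_ofFn]; omega)
  have hd : DifferentiableOn ℂ (mellin (itoKernel (List.replicate l 1 ++ List.ofFn k)))
      {s | 1 - ((l : ℝ) + r) < s.re} := fun s hs =>
    (mellin_differentiableAt_of_isBigO_rpow_exp (by norm_num) (locallyIntegrableOn_itoKernel hk)
      (isBigO_atTop_itoKernel hk) (isBigO_zero_itoKernel hr) hs).differentiableWithinAt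
  obtain ⟨F, hF, hF'⟩ := exists_entire_inv_Gamma_mul_mellin (by norm_num)
    (locallyIntegrableOn_itoKernel hk) (isBigO_atTop_itoKernel hk)
    (h := fun z => z ^ ((List.replicate l 1 ++ List.ofFn k).length - 1) * g z)
    ((analyticAt_id.pow _).mul hg)
    (by filter_upwards [self_mem_nhdsWithin] with t ht using h t ht) hd
  have hval : ∀ s : ℂ, 1 - ((l : ℝ) + r) < s.re →
      F s = itoIntegral (List.replicate l 1 ++ List.ofFn k) s := fun s hs => by
    rw [hF' s hs, itoIntegral_eq_mellin]
  have hxi : xiMT (List.replicate l 1 ++ List.ofFn k) = F :=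
    meromorphicContinuation_eq ⟨fun s _ => (hF.analyticAt s).meromorphicNFAt, _, hval⟩
  rw [hxi]
  exact ⟨hF, hval⟩

/-! ### The identity on `Re s > 1` and its continuation. -/

theorem mellin_itoKernel_eq_sum (hk : ∀ i, 2 ≤ k i) {s : ℂ} (hs : 1 < s.re) :
    mellin (itoKernel (List.replicate l 1 ++ List.ofFn k)) s = ∑ j ∈ indexRange k,
      prodA j k * (Gamma (l + countB j k + s) * gmtZeta (blocks j k) (l + countB j k + s)) := by
  have h1 : ∀ j : Fin r → ℕ, HasMellin (fun t : ℝ => prodA j k *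
      ((t : ℂ) ^ ((l + countB j k : ℕ) : ℂ) * gmtTheta (blocks j k) t)) s
      (prodA j k *
        (Gamma (l + countB j k + s) * gmtZeta (blocks j k) (l + countB j k + s))) := by
    intro j
    have hS := isBlockFamily_blocks j k
    have hs' : 1 < (s + ((l + countB j k : ℕ) : ℂ)).re := by
      rw [add_re, natCast_re]
      linarith [(Nat.cast_nonneg (l + countB j k) : (0 : ℝ) ≤ _)]
    have hc : MellinConvergent (fun t : ℝ => (t : ℂ) ^ ((l + countB j k : ℕ) : ℂ) •
        gmtTheta (blocks j k) t) s := MellinConvergent.cpow_smul.2 (hS.mellinConvergent hs')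
    have h2 := hasMellin_const_smul hc (prodA j k)
    have heq : s + ((l + countB j k : ℕ) : ℂ) = l + countB j k + s := by
      push_cast
      ring
    rw [mellin_cpow_smul, hS.mellin_gmtTheta hs', ← hS.gmtZeta_spec.2 _ hs', heq] at h2
    exact h2
  have h2 : ∀ A : Finset (Fin r → ℕ), HasMellin (fun t : ℝ => ∑ j ∈ A, prodA j k *
      ((t : ℂ) ^ ((l + countB j k : ℕ) : ℂ) * gmtTheta (blocks j k) t)) s (∑ j ∈ A,
      prodA j k *
        (Gamma (l + countB j k + s) * gmtZeta (blocks j k) (l + countB j k + s))) := by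
    intro A
    induction A using Finset.induction_on with
    | empty => simp [HasMellin, MellinConvergent, mellin]
    | insert j A hj ih =>
      have := hasMellin_add (h1 j).1 ih.1
      rw [(h1 j).2, ih.2] at this
      simpa only [Finset.sum_insert hj] using this
  rw [← (h2 _).2]
  refine setIntegral_congr_fun measurableSet_Ioi fun t ht => ?_
  dsimp only
  rw [itoKernel_eq_sum hk ht]

theorem xiMT_eq_gmtSum_of_one_lt_re (hr : 0 < r) (hk : ∀ i, 2 ≤ k i) {s : ℂ} (hs : 1 < s.re) :
    xiMT (List.replicate l 1 ++ List.ofFn k) s = gmtSum l k s := by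
  have hs' : 1 - ((l : ℝ) + r) < s.re := by
    have : (0 : ℝ) ≤ l := Nat.cast_nonneg l
    have : (0 : ℝ) ≤ r := Nat.cast_nonneg r
    linarith
  rw [(xiMT_spec hr hk).2 s hs', itoIntegral_eq_mellin, mellin_itoKernel_eq_sum hk hs, gmtSum,
    Finset.mul_sum]
  refine Finset.sum_congr rfl fun j _ => ?_
  rw [div_eq_mul_inv]
  ring

theorem meromorphicOn_gmtSum : MeromorphicOn (gmtSum l k) univ := by
  intro s _
  refine MeromorphicAt.fun_sum (G := fun j s => prodA j k *
    (Gamma (l + countB j k + s) / Gamma s) * gmtZeta (blocks j k) (l + countB j k + s))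
    fun j _ => ?_
  have hshift : AnalyticAt ℂ (fun z : ℂ => (l : ℂ) + countB j k + z) s := by fun_prop
  refine MeromorphicAt.mul (MeromorphicAt.mul (MeromorphicAt.const _ _) (MeromorphicAt.div ?_ ?_)) ?_
  · exact (Meromorphic.Gamma _).comp_analyticAt hshift
  · exact Meromorphic.Gamma s
  · exact ((isBlockFamily_blocks j k).gmtZeta_spec.1.meromorphicOn _
      (mem_univ _)).comp_analyticAt hshift

/-- The two sides agree as meromorphic functions. -/
theorem gmtSum_eventuallyEq_xiMT (hr : 0 < r) (hk : ∀ i, 2 ≤ k i) (s : ℂ) :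
    gmtSum l k =ᶠ[𝓝[≠] s] xiMT (List.replicate l 1 ++ List.ofFn k) := by
  have hd := (xiMT_spec (l := l) hr hk).1
  have hval : ∀ z : ℂ, 1 < z.re → toMeromorphicNFOn (gmtSum l k) univ z =
      xiMT (List.replicate l 1 ++ List.ofFn k) z := by
    intro z hz
    rw [toMeromorphicNFOn_apply_of_analyticAt meromorphicOn_gmtSum (mem_univ z),
      xiMT_eq_gmtSum_of_one_lt_re hr hk hz]
    refine (hd.analyticAt z).congr ?_
    filter_upwards [(isOpen_halfPlane 1).mem_nhds hz] with w hw
    exact xiMT_eq_gmtSum_of_one_lt_re hr hk hw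
  have heq : toMeromorphicNFOn (gmtSum l k) univ = xiMT (List.replicate l 1 ++ List.ofFn k) :=
    IsMeromorphicContinuation.unique ⟨meromorphicNFOn_toMeromorphicNFOn _ _, 1, hval⟩
      ⟨fun z _ => (hd.analyticAt z).meromorphicNFAt, 1, fun z _ => rfl⟩
  rw [← heq]
  -- Normalisation leaves a meromorphic function unchanged on a punctured neighbourhood of each
  -- point.
  exact (meromorphicOn_gmtSum.toMeromorphicNFOn_eq_self_on_nhdsNE (mem_univ s)).symm

theorem continuousAt_gmtSum {s : ℂ} (hs : ∀ n : ℕ, s ≠ -n)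
    (h : ∀ j ∈ indexRange k, AnalyticAt ℂ (gmtZeta (blocks j k)) (l + countB j k + s)) :
    ContinuousAt (gmtSum l k) s := by
  refine tendsto_finsetSum _ fun j hj => ?_
  have hshift : ContinuousAt (fun z : ℂ => (l : ℂ) + countB j k + z) s := by fun_prop
  have hne : ∀ n : ℕ, (l : ℂ) + countB j k + s ≠ -n := fun n hn => by
    refine hs (n + l + countB j k) ?_
    push_cast
    linear_combination hn
  refine (tendsto_const_nhds.mul (Tendsto.div ?_ ?_ (Gamma_ne_zero hs))).mul ?_
  · exact ContinuousAt.comp' (f := fun z : ℂ => (l : ℂ) + countB j k + z)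
      (differentiableAt_Gamma _ hne).continuousAt hshift
  · exact (differentiableAt_Gamma _ hs).continuousAt
  · exact ContinuousAt.comp' (f := fun z : ℂ => (l : ℂ) + countB j k + z)
      (h j hj).continuousAt hshift

end

end ItoGMT

theorem mainTheorem3 (l r : ℕ) (hr : 0 < r) (k : Fin r → ℕ) (hk : ∀ i, 2 ≤ k i) :
    -- the Ito zeta function `ξ_MT({1}^l, k_1, …, k_r; s)` is an entire function, given by
    -- its (absolutely convergent) integral for `Re s > 1 - (l + r)`
    (Differentiable ℂ (ItoGMT.xiMT (List.replicate l 1 ++ List.ofFn k)) ∧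
      ∀ s : ℂ, 1 - ((l : ℝ) + r) < s.re →
        IntegrableOn (ItoGMT.itoIntegrand (List.replicate l 1 ++ List.ofFn k) s) (Set.Ioi 0) ∧
        ItoGMT.xiMT (List.replicate l 1 ++ List.ofFn k) s =
          ItoGMT.itoIntegral (List.replicate l 1 ++ List.ofFn k) s) ∧
    -- each generalized Mordell-Tornheim function in the sum is meromorphic on `ℂ`, given by
    -- its absolutely convergent series for `Re s > 1`
    (∀ j ∈ ItoGMT.indexRange k,
      MeromorphicNFOn (ItoGMT.gmtZeta (ItoGMT.blocks j k)) Set.univ ∧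
      ∀ s : ℂ, 1 < s.re →
        Summable (ItoGMT.gmtTerm (ItoGMT.blocks j k) s) ∧
        ItoGMT.gmtZeta (ItoGMT.blocks j k) s = ItoGMT.gmtSeries (ItoGMT.blocks j k) s) ∧
    -- the identity holds at each `s` at which all the terms are regular
    (∀ s : ℂ, (∀ n : ℕ, s ≠ -n) →
      (∀ j ∈ ItoGMT.indexRange k,
        AnalyticAt ℂ (ItoGMT.gmtZeta (ItoGMT.blocks j k)) (l + ItoGMT.countB j k + s)) →
      ItoGMT.xiMT (List.replicate l 1 ++ List.ofFn k) s = ItoGMT.gmtSum l k s) ∧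
    -- and at each `s` whatsoever the sum has at most a removable singularity, with the value
    -- of the Ito zeta function as its limit
    (∀ s : ℂ, Tendsto (ItoGMT.gmtSum l k) (𝓝[≠] s)
      (𝓝 (ItoGMT.xiMT (List.replicate l 1 ++ List.ofFn k) s))) := by
  obtain ⟨hd, hval⟩ := ItoGMT.xiMT_spec (l := l) hr hk
  -- Mellin convergence of the kernel unfolds to integrability of the integrand.
  refine ⟨⟨hd, fun s hs => ⟨ItoGMT.mellinConvergent_itoKernel hr hk hs, hval s hs⟩⟩,
    fun j _ => ?_, fun s hs han => ?_, fun s => ?_⟩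
  · have hS := ItoGMT.isBlockFamily_blocks j k
    exact ⟨hS.gmtZeta_spec.1, fun s hs => ⟨hS.summable_gmtTerm hs, hS.gmtZeta_spec.2 s hs⟩⟩
  -- At a regular point both sides are continuous, so agreement on a punctured neighbourhood forces
  -- equal values.
  · have h1 : Tendsto (ItoGMT.gmtSum l k) (𝓝[≠] s) (𝓝 (ItoGMT.gmtSum l k s)) :=
      (ItoGMT.continuousAt_gmtSum hs han).tendsto.mono_left nhdsWithin_le_nhds
    have h2 := (hd.continuous.tendsto s).mono_left (nhdsWithin_le_nhds (s := {s}ᶜ))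
    exact tendsto_nhds_unique (h2.congr' (ItoGMT.gmtSum_eventuallyEq_xiMT hr hk s).symm) h1
  · exact ((hd.continuous.tendsto s).mono_left nhdsWithin_le_nhds).congr'
      (ItoGMT.gmtSum_eventuallyEq_xiMT hr hk s).symm
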